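/- **Theorem.** Let $M$ be a smooth manifold of dimension $n$ and $(M,\mathcal D,F)$ a nonholonomic sub-Finslerian structure: $\mathcal D\subset TM$ is a bracket-generating smooth subbundle of constant rank $k<n$, and $F:\mathcal D\to[0,\infty)$ is smooth off the zero section, satisfies $F(\lambda v)=|\lambda|F(v)$ for all $\lambda\in\mathbb R$, and the Hessian of $F^2$ on $\mathcal D_x$ is positive definite at every $v\in\mathcal D_x\setminus 0$. Let $g$ be a Riemannian metric on $M$, $P:TM\to\mathcal D$ the $g$-orthogonal projection, $P^c=1-P$ the projection onto $\mathcal D^\perp$, and let $\mathcal D^0\subset T^*M$ be the annihilator of $\mathcal D$. Put $P^*\alpha=\alpha\circ(1-P)\in\mathcal D^0$ and $(P^*)^c\alpha=\alpha\circ P\in\mathcal D^*$, where $\mathcal D^*$ is identified with the annihilator of $\mathcal D^\perp$. Let $\mathcal L_L(v)\in\mathcal D^*$ be the Legendre transform of $v\in\mathcal D$ for $L=\tfrac12F^2$. Extend $L$ to $TM$ by $\hat L(v)=\tfrac12\big(F(Pv)^2+g(P^cv,P^cv)\big)$, and put, in coordinates, $G^i=g^{ij}\big(\frac{\partial^2\hat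 L}{\partial v^j\partial x^k}v^k-\frac{\partial\hat L}{\partial x^j}\big)$ with $(g^{ij})$ the inverse of $\big(\frac{\partial^2\hat L}{\partial v^i\partial v^j}\big)$, and $N^i_j=\tfrac12\frac{\partial G^i}{\partial v^j}$. For a covector field $\alpha$ along a curve $\sigma$ let $(\overline\nabla^B_{\dot\sigma}\alpha)_i=\dot\alpha_i-N^j_i(\sigma,\dot\sigma)\alpha_j$ (Barthel derivative), and $\nabla^H_{\dot\sigma}\alpha=(P^*)^c(\overline\nabla^B_{\dot\sigma}\alpha)$, $T^B(\dot\sigma,\alpha)=P^*(\overline\nabla^B_{\dot\sigma}\alpha)$. For a section $\gamma$ of $\mathcal D^0$ along a curve $\sigma$ tangent to $\mathcal D$ let $\nabla^T_{\dot\sigma}\gamma=P^*(i_{\dot\sigma}d\gamma)$, where $(i_{\dot\sigma}d\gamma)(Y)=\frac{d}{dt}\gamma(Y)-\gamma([X,Y])$ at $\sigma(t)$, with $X$ any local section of $\mathcal D$ such that $X(\sigma(t))=\dot\sigma(t)$. Let $\sigma:[0,1]\to M$ be a horizontal curve, i.e. differentiable with $\dot\sigma(t)\in\mathcal D_{\sigma(t)}$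 for all $t$. It *solves the free nonholonomic problem* if $\nabla^H_{\dot\sigma}\mathcal L_L(\dot\sigma)=0$. It *solves the vakonomic problem* if it is a normal extremal: it has a lift $\alpha(t)\in T^*_{\sigma(t)}M$ that solves Hamilton's equations $\dot x^i=\partial\eta/\partial p_i$, $\dot p_i=-\partial\eta/\partial x^i$ for the sub-Hamiltonian $\eta(x,p)=\tfrac12\big(\sup\{\langle p,v\rangle: v\in\mathcal D_x,\ F(v)=1\}\big)^2$ on $T^*M$. A section $\gamma$ of $\mathcal D^0$ along $\sigma$ is a *multiplier* of this solution if $\alpha=\mathcal L_L(\dot\sigma)+\gamma$ is such a lift. Consider for sections $\gamma$ of $\mathcal D^0$ along $\sigma$ the condition $$(\ast)\qquad \nabla^T_{\dot\sigma}\gamma(t)=-T^B\big(\dot\sigma(t),\mathcal L_L(\dot\sigma(t))\big)\quad\text{and}\quad \gamma(t)\in\big(\mathcal D_{\sigma(t)}+[\dot\sigma(t),\mathcal D_{\sigma(t)}]\big)^0\qquad\text{for all }t\in[0,1].$$ 1. If $\sigma$ solves the free nonholonomic problem, then it solves the vakonomic problem if and only if there is a section $\gamma$ of $\mathcal D^0$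 along $\sigma$ with $(\ast)$. 2. Conversely, if $\sigma$ solves the vakonomic problem, then it solves the free nonholonomic problem if and only if it has a multiplier $\gamma$ with $(\ast)$. 3. For every section $\gamma$ of $\mathcal D^0$ along $\sigma$: if $\sigma$ solves the free nonholonomic problem, then $\gamma$ is a multiplier if and only if $(\ast)$ holds; and if $\gamma$ is a multiplier, then $\sigma$ solves the free nonholonomic problem if and only if $(\ast)$ holds. -/

import Mathlib

open Set Filter Topology Bundle
open scoped Manifold ContDiff

noncomputable section

namespace SubFinsler

section Distributions

variable {E : Type*} [NormedAddCommGroup E] [NormedSpace ℝ E] [FiniteDimensional ℝ E]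
  {M : Type*} [TopologicalSpace M] [ChartedSpace E M] [IsManifold 𝓘(ℝ, E) ∞ M]

/-- The vector field `X` is `C^∞` on a neighbourhood of `x`. -/
def SmoothNear (X : (y : M) → TangentSpace 𝓘(ℝ, E) y) (x : M) : Prop :=
  ∀ᶠ y in 𝓝 x, ContMDiffAt 𝓘(ℝ, E) 𝓘(ℝ, E).tangent ∞
    (fun z => (⟨z, X z⟩ : TangentBundle 𝓘(ℝ, E) M)) y

/-- `X` is a smooth section of the distribution `D` on a neighbourhood of `x`. -/
def SectionNear (D : (y : M) → Submodule ℝ (TangentSpace 𝓘(ℝ, E) y))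
    (X : (y : M) → TangentSpace 𝓘(ℝ, E) y) (x : M) : Prop :=
  SmoothNear X x ∧ ∀ᶠ y in 𝓝 x, X y ∈ D y

/-- The successive Lie brackets of local smooth sections of `D` near `x`. -/
inductive IteratedBracket (D : (y : M) → Submodule ℝ (TangentSpace 𝓘(ℝ, E) y)) (x : M) :
    ((y : M) → TangentSpace 𝓘(ℝ, E) y) → Prop
  | base (X : (y : M) → TangentSpace 𝓘(ℝ, E) y) (hX : SectionNear D X x) :
      IteratedBracket D x X
  | bracket (X Y : (y : M) → TangentSpace 𝓘(ℝ, E) y)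
      (hX : IteratedBracket D x X) (hY : IteratedBracket D x Y) :
      IteratedBracket D x (VectorField.mlieBracket 𝓘(ℝ, E) X Y)

end Distributions

/-- A nonholonomic sub-Finslerian structure `(M, D, F)`: a bracket-generating smooth distribution
`D` of constant rank `k < dim M`, with a sub-Finsler metric `F` on `D`.  Only the values of `F` at
vectors of `D` matter. -/
structure NonholonomicStructure (E : Type*) [NormedAddCommGroup E] [NormedSpace ℝ E] [FiniteDimensional ℝ E]
    (M : Type*) [TopologicalSpace M] [ChartedSpace E M] [IsManifold 𝓘(ℝ, E) ∞ M] (k : ℕ) where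
  D : (x : M) → Submodule ℝ (TangentSpace 𝓘(ℝ, E) x)
  rank_eq : ∀ x, Module.finrank ℝ (D x) = k
  rank_lt : k < Module.finrank ℝ E
  exists_frame : ∀ x, ∃ X : Fin k → (y : M) → TangentSpace 𝓘(ℝ, E) y,
    (∀ i, SmoothNear (X i) x) ∧
    ∀ᶠ y in 𝓝 x, Submodule.span ℝ (range fun i => X i y) = D y
  bracket_generating : ∀ x,
    Submodule.span ℝ {v | ∃ X : (y : M) → TangentSpace 𝓘(ℝ, E) y,
      IteratedBracket D x X ∧ X x = v} = ⊤
  F : (x : M) → TangentSpace 𝓘(ℝ, E) x → ℝ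
  F_nonneg : ∀ x, ∀ v ∈ D x, 0 ≤ F x v
  F_smooth : ContMDiffOn 𝓘(ℝ, E).tangent 𝓘(ℝ, ℝ) ∞
    (fun w : TangentBundle 𝓘(ℝ, E) M => F w.1 w.2) {w | w.2 ∈ D w.1 ∧ w.2 ≠ 0}
  F_homogeneous : ∀ x, ∀ v ∈ D x, ∀ c : ℝ, F x (c • v) = |c| * F x v
  /-- The Hessian of `F ^ 2` on `D x` at `v ≠ 0` is positive definite. -/
  F_convex : ∀ x, ∀ v ∈ D x, v ≠ 0 → ∀ w ∈ D x, w ≠ 0 →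
    0 < iteratedDeriv 2 (fun s : ℝ => F x (v + s • w) ^ 2) 0

variable {E : Type*} [NormedAddCommGroup E] [NormedSpace ℝ E] [FiniteDimensional ℝ E]
  {M : Type*} [TopologicalSpace M] [ChartedSpace E M] [IsManifold 𝓘(ℝ, E) ∞ M] {k : ℕ}

instance (x : M) : FiniteDimensional ℝ (TangentSpace 𝓘(ℝ, E) x) :=
  inferInstanceAs (FiniteDimensional ℝ E)

instance (x : M) : T2Space (TangentSpace 𝓘(ℝ, E) x) :=
  inferInstanceAs (T2Space E)

/-! ### Orthogonal complement and projections -/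

/-- The `g`-orthogonal complement of `D` at `x`. -/
def perp (S : NonholonomicStructure E M k)
    (g : ContMDiffRiemannianMetric 𝓘(ℝ, E) ∞ E (fun x : M => TangentSpace 𝓘(ℝ, E) x)) (x : M) :
    Submodule ℝ (TangentSpace 𝓘(ℝ, E) x) where
  carrier := {v | ∀ w ∈ S.D x, g.inner x w v = 0}
  add_mem' := fun ha hb w hw => by simp [ha w hw, hb w hw]
  zero_mem' := fun w _ => by simp
  smul_mem' := fun c v hv w hw => by simp [hv w hw]

theorem isCompl_perp (S : NonholonomicStructure E M k)
    (g : ContMDiffRiemannianMetric 𝓘(ℝ, E) ∞ E (fun x : M => TangentSpace 𝓘(ℝ, E) x)) (x : M) :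
    IsCompl (S.D x) (perp S g x) := by
  let B : LinearMap.BilinForm ℝ (TangentSpace 𝓘(ℝ, E) x) :=
    LinearMap.mk₂ ℝ (fun v w => g.inner x v w) (by simp) (by simp) (by simp) (by simp)
  have hB : B.IsRefl := fun v w h => by
    have h' : g.inner x v w = 0 := h
    change g.inner x w v = 0
    rw [g.symm, h']
  have hperp : perp S g x = B.orthogonal (S.D x) := by
    ext v
    rfl
  rw [hperp, LinearMap.BilinForm.isCompl_orthogonal_iff_disjoint hB, Submodule.disjoint_def]
  intro v hv hv'
  by_contra h0
  have h1 : g.inner x v v = 0 := hv' v hv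
  exact (g.pos x v h0).ne' h1

/-- The projection `P` of `T_x M` onto `D_x` along the orthogonal complement of `D_x`. -/
def proj (S : NonholonomicStructure E M k)
    (g : ContMDiffRiemannianMetric 𝓘(ℝ, E) ∞ E (fun x : M => TangentSpace 𝓘(ℝ, E) x)) (x : M) :
    TangentSpace 𝓘(ℝ, E) x →L[ℝ] TangentSpace 𝓘(ℝ, E) x :=
  LinearMap.toContinuousLinearMap (Submodule.projection (S.D x) (perp S g x) (isCompl_perp S g x))

/-- `P^* α = α ∘ (1 - P)`, the part of a covector in the annihilator `D^0` of `D`. -/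
def coProj (S : NonholonomicStructure E M k)
    (g : ContMDiffRiemannianMetric 𝓘(ℝ, E) ∞ E (fun x : M => TangentSpace 𝓘(ℝ, E) x)) (x : M)
    (α : TangentSpace 𝓘(ℝ, E) x →L[ℝ] ℝ) : TangentSpace 𝓘(ℝ, E) x →L[ℝ] ℝ :=
  α ∘L (ContinuousLinearMap.id ℝ (TangentSpace 𝓘(ℝ, E) x) - proj S g x)

/-- `(P^*)^c α = α ∘ P`, the part of a covector in the annihilator of the complement of `D`,
that is, in `D^*`. -/
def coProjCompl (S : NonholonomicStructure E M k)
    (g : ContMDiffRiemannianMetric 𝓘(ℝ, E) ∞ E (fun x : M => TangentSpace 𝓘(ℝ, E) x)) (x : M)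
    (α : TangentSpace 𝓘(ℝ, E) x →L[ℝ] ℝ) : TangentSpace 𝓘(ℝ, E) x →L[ℝ] ℝ :=
  α ∘L proj S g x

/-! ### Legendre transformation, sub-Hamiltonian, extended Lagrangian -/

/-- The Legendre transformation of the sub-Lagrangian `L = F ^ 2 / 2` at `v ∈ D_x`, as a covector
that vanishes on the orthogonal complement of `D_x`. -/
def legendre (S : NonholonomicStructure E M k)
    (g : ContMDiffRiemannianMetric 𝓘(ℝ, E) ∞ E (fun x : M => TangentSpace 𝓘(ℝ, E) x)) (x : M)
    (v : TangentSpace 𝓘(ℝ, E) x) : TangentSpace 𝓘(ℝ, E) x →L[ℝ] ℝ :=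
  fderiv ℝ (fun u : TangentSpace 𝓘(ℝ, E) x => (1 / 2 : ℝ) * S.F x (proj S g x u) ^ 2) v

/-- The dual metric `F^*` of the restriction to `D_x` of a covector. -/
def dualF (S : NonholonomicStructure E M k) (x : M) (α : TangentSpace 𝓘(ℝ, E) x →L[ℝ] ℝ) : ℝ :=
  sSup {r | ∃ v ∈ S.D x, S.F x v = 1 ∧ r = α v}

/-- The sub-Hamiltonian `η = (F^*) ^ 2 / 2`, as a function on `T^*M`. -/
def subHamiltonian (S : NonholonomicStructure E M k) (x : M) (α : TangentSpace 𝓘(ℝ, E) x →L[ℝ] ℝ) : ℝ :=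
  (1 / 2 : ℝ) * dualF S x α ^ 2

/-- The Lagrangian `(F(P v) ^ 2 + g(P^c v, P^c v)) / 2` of the extension of `F` to `TM` by the
norm of `g` on the orthogonal complement of `D`. -/
def extLagrangian (S : NonholonomicStructure E M k)
    (g : ContMDiffRiemannianMetric 𝓘(ℝ, E) ∞ E (fun x : M => TangentSpace 𝓘(ℝ, E) x)) (x : M)
    (v : TangentSpace 𝓘(ℝ, E) x) : ℝ :=
  (1 / 2 : ℝ) * (S.F x (proj S g x v) ^ 2 +
    g.inner x (v - proj S g x v) (v - proj S g x v))

/-! ### Coordinate expressions in the chart at a point `o` -/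

/-- The frame `E → T_y M` of the coordinates of the chart at `o`. -/
def frame (o y : M) : E →L[ℝ] TangentSpace 𝓘(ℝ, E) y :=
  (trivializationAt E (TangentSpace 𝓘(ℝ, E)) o).symmL ℝ y

/-- The components `T_y M → E` of a tangent vector in the coordinates of the chart at `o`. -/
def coframe (o y : M) : TangentSpace 𝓘(ℝ, E) y →L[ℝ] E :=
  (trivializationAt E (TangentSpace 𝓘(ℝ, E)) o).continuousLinearMapAt ℝ y

/-- The extended Lagrangian in coordinates `(z, v)`. -/
def lagrangianCoord (S : NonholonomicStructure E M k)
    (g : ContMDiffRiemannianMetric 𝓘(ℝ, E) ∞ E (fun x : M => TangentSpace 𝓘(ℝ, E) x)) (o : M)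
    (z v : E) : ℝ :=
  extLagrangian S g ((extChartAt 𝓘(ℝ, E) o).symm z) (frame o _ v)

/-- The sub-Hamiltonian in canonical coordinates `(z, p)`. -/
def hamiltonianCoord (S : NonholonomicStructure E M k) (o : M) (z : E) (p : E →L[ℝ] ℝ) : ℝ :=
  subHamiltonian S ((extChartAt 𝓘(ℝ, E) o).symm z) (p ∘L coframe o _)

/-- The coefficients `G^i = g^{ij} (∂²L/∂v^j∂x^k v^k - ∂L/∂x^j)`, where `g_{ij}` is the Hessian
`∂²L/∂v^i∂v^j` of the extended Lagrangian. -/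
def sprayCoord (S : NonholonomicStructure E M k)
    (g : ContMDiffRiemannianMetric 𝓘(ℝ, E) ∞ E (fun x : M => TangentSpace 𝓘(ℝ, E) x)) (o : M)
    (z v : E) : E :=
  (fderiv ℝ (fun u : E => fderiv ℝ (lagrangianCoord S g o z) u) v).inverse
    (fderiv ℝ (fun y : E => fderiv ℝ (lagrangianCoord S g o y) v) z v
      - fderiv ℝ (fun y : E => lagrangianCoord S g o y v) z)

/-- The nonlinear connection `N^i_j = (1/2) ∂G^i/∂v^j`, as the linear map `Y ↦ N^i_j Y^j`. -/
def connCoord (S : NonholonomicStructure E M k)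
    (g : ContMDiffRiemannianMetric 𝓘(ℝ, E) ∞ E (fun x : M => TangentSpace 𝓘(ℝ, E) x)) (o : M)
    (z v : E) : E →L[ℝ] E :=
  (1 / 2 : ℝ) • fderiv ℝ (sprayCoord S g o z) v

/-! ### Curves `σ : [0, 1] → M` and covector fields along them -/

/-- The velocity of `σ`. -/
def velocity (σ : ℝ → M) (t : ℝ) : TangentSpace 𝓘(ℝ, E) (σ t) :=
  mfderivWithin 𝓘(ℝ, ℝ) 𝓘(ℝ, E) σ (Icc 0 1) t (1 : ℝ)

/-- `σ` is a horizontal curve. -/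
def IsHorizontal (S : NonholonomicStructure E M k) (σ : ℝ → M) : Prop :=
  MDifferentiableOn 𝓘(ℝ, ℝ) 𝓘(ℝ, E) σ (Icc 0 1) ∧
    ∀ t ∈ Icc (0 : ℝ) 1, velocity (E := E) σ t ∈ S.D (σ t)

/-- `ξ` is the Barthel covariant derivative at time `t`, along `σ` in the direction of its velocity,
of the covector field `α` along `σ`; in coordinates `ξ_i = dα_i/dt - N^j_i(σ, dσ/dt) α_j`. -/
def HasBarthelDeriv (S : NonholonomicStructure E M k)
    (g : ContMDiffRiemannianMetric 𝓘(ℝ, E) ∞ E (fun x : M => TangentSpace 𝓘(ℝ, E) x))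
    (σ : ℝ → M) (α : (t : ℝ) → TangentSpace 𝓘(ℝ, E) (σ t) →L[ℝ] ℝ) (t : ℝ)
    (ξ : TangentSpace 𝓘(ℝ, E) (σ t) →L[ℝ] ℝ) : Prop :=
  HasDerivWithinAt (fun s => α s ∘L frame (σ t) (σ s))
    (ξ ∘L frame (σ t) (σ t) +
      (α t ∘L frame (σ t) (σ t)) ∘L
        connCoord S g (σ t) (extChartAt 𝓘(ℝ, E) (σ t) (σ t))
          (coframe (σ t) (σ t) (velocity σ t)))
    (Icc 0 1) t

/-- `β` is the derivative `∇^H α = (P^*)^c (∇^B α)` along `σ` at time `t`. -/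
def HasNablaH (S : NonholonomicStructure E M k)
    (g : ContMDiffRiemannianMetric 𝓘(ℝ, E) ∞ E (fun x : M => TangentSpace 𝓘(ℝ, E) x))
    (σ : ℝ → M) (α : (t : ℝ) → TangentSpace 𝓘(ℝ, E) (σ t) →L[ℝ] ℝ) (t : ℝ)
    (β : TangentSpace 𝓘(ℝ, E) (σ t) →L[ℝ] ℝ) : Prop :=
  ∃ ξ, HasBarthelDeriv S g σ α t ξ ∧ β = coProjCompl S g (σ t) ξ

/-- `β` is the value `T^B(dσ/dt, α) = P^* (∇^B α)` along `σ` at time `t`. -/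
def HasTB (S : NonholonomicStructure E M k)
    (g : ContMDiffRiemannianMetric 𝓘(ℝ, E) ∞ E (fun x : M => TangentSpace 𝓘(ℝ, E) x))
    (σ : ℝ → M) (α : (t : ℝ) → TangentSpace 𝓘(ℝ, E) (σ t) →L[ℝ] ℝ) (t : ℝ)
    (β : TangentSpace 𝓘(ℝ, E) (σ t) →L[ℝ] ℝ) : Prop :=
  ∃ ξ, HasBarthelDeriv S g σ α t ξ ∧ β = coProj S g (σ t) ξ

/-- `ξ` is the value `δ_X γ = i_X dγ` at `σ t` for `X = dσ/dt`, where `γ` is a section of `D^0`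
along `σ`: one has `(i_X dγ)(Y) = X(γ(Y)) - γ([X, Y])` since `γ` vanishes on the sections `X` of
`D`, and the derivative of `γ(Y)` in the direction of `X` is the one along `σ`. -/
def HasDelta (S : NonholonomicStructure E M k)
    (σ : ℝ → M) (γ : (t : ℝ) → TangentSpace 𝓘(ℝ, E) (σ t) →L[ℝ] ℝ) (t : ℝ)
    (ξ : TangentSpace 𝓘(ℝ, E) (σ t) →L[ℝ] ℝ) : Prop :=
  ∀ X Y : (y : M) → TangentSpace 𝓘(ℝ, E) y,
    SectionNear S.D X (σ t) → X (σ t) = velocity σ t → SmoothNear Y (σ t) →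
      HasDerivWithinAt (fun s => γ s (Y (σ s)))
        (ξ (Y (σ t)) + γ t (VectorField.mlieBracket 𝓘(ℝ, E) X Y (σ t))) (Icc 0 1) t

/-- `β` is the derivative `∇^T γ = P^* (δ_X γ)`, `X = dσ/dt`, along `σ` at time `t`. -/
def HasNablaT (S : NonholonomicStructure E M k)
    (g : ContMDiffRiemannianMetric 𝓘(ℝ, E) ∞ E (fun x : M => TangentSpace 𝓘(ℝ, E) x))
    (σ : ℝ → M) (γ : (t : ℝ) → TangentSpace 𝓘(ℝ, E) (σ t) →L[ℝ] ℝ) (t : ℝ)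
    (β : TangentSpace 𝓘(ℝ, E) (σ t) →L[ℝ] ℝ) : Prop :=
  ∃ ξ, HasDelta S σ γ t ξ ∧ β = coProj S g (σ t) ξ

/-- The momentum `L_L(dσ/dt)` along `σ`. -/
def momentum (S : NonholonomicStructure E M k)
    (g : ContMDiffRiemannianMetric 𝓘(ℝ, E) ∞ E (fun x : M => TangentSpace 𝓘(ℝ, E) x))
    (σ : ℝ → M) (t : ℝ) : TangentSpace 𝓘(ℝ, E) (σ t) →L[ℝ] ℝ :=
  legendre S g (σ t) (velocity σ t)

/-- The horizontal curve `σ` solves the free nonholonomic problem: `∇^H (L_L(dσ/dt)) = 0`. -/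
def SolvesNonholonomic (S : NonholonomicStructure E M k)
    (g : ContMDiffRiemannianMetric 𝓘(ℝ, E) ∞ E (fun x : M => TangentSpace 𝓘(ℝ, E) x))
    (σ : ℝ → M) : Prop :=
  ∀ t ∈ Icc (0 : ℝ) 1, HasNablaH S g σ (momentum S g σ) t 0

/-- `α` is a lift of `σ` to `T^*M` that solves the sub-Hamiltonian equations
`dx^i/dt = ∂η/∂p_i`, `dp_i/dt = - ∂η/∂x^i`. -/
def IsNormalLift (S : NonholonomicStructure E M k) (σ : ℝ → M)
    (α : (t : ℝ) → TangentSpace 𝓘(ℝ, E) (σ t) →L[ℝ] ℝ) : Prop :=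
  ∀ t ∈ Icc (0 : ℝ) 1,
    (∀ q : E →L[ℝ] ℝ, q (coframe (σ t) (σ t) (velocity σ t)) =
      fderiv ℝ (hamiltonianCoord S (σ t) (extChartAt 𝓘(ℝ, E) (σ t) (σ t)))
        (α t ∘L frame (σ t) (σ t)) q) ∧
    HasDerivWithinAt (fun s => α s ∘L frame (σ t) (σ s))
      (-fderiv ℝ (fun z => hamiltonianCoord S (σ t) z (α t ∘L frame (σ t) (σ t)))
        (extChartAt 𝓘(ℝ, E) (σ t) (σ t)))
      (Icc 0 1) t

/-- The horizontal curve `σ` solves the vakonomic problem: it is a normal extremal. -/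
def SolvesVakonomic (S : NonholonomicStructure E M k) (σ : ℝ → M) : Prop :=
  ∃ α : (t : ℝ) → TangentSpace 𝓘(ℝ, E) (σ t) →L[ℝ] ℝ, IsNormalLift S σ α

/-- `γ` is a section of the annihilator `D^0` of `D` along `σ`. -/
def IsAnnihilatorSection (S : NonholonomicStructure E M k) (σ : ℝ → M)
    (γ : (t : ℝ) → TangentSpace 𝓘(ℝ, E) (σ t) →L[ℝ] ℝ) : Prop :=
  ∀ t ∈ Icc (0 : ℝ) 1, ∀ w ∈ S.D (σ t), γ t w = 0

/-- `γ` is the multiplier of a solution of the vakonomic problem with base curve `σ`: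
a section of `D^0` along `σ` such that `L_L(dσ/dt) + γ` solves the sub-Hamiltonian equations. -/
def IsVakonomicMultiplier (S : NonholonomicStructure E M k)
    (g : ContMDiffRiemannianMetric 𝓘(ℝ, E) ∞ E (fun x : M => TangentSpace 𝓘(ℝ, E) x))
    (σ : ℝ → M) (γ : (t : ℝ) → TangentSpace 𝓘(ℝ, E) (σ t) →L[ℝ] ℝ) : Prop :=
  IsAnnihilatorSection S σ γ ∧ IsNormalLift S σ (fun t => momentum S g σ t + γ t)

/-- The subspace `D_x + [v, D_x]` of `T_x M`, for `v ∈ D_x`. -/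
def bracketSpan (S : NonholonomicStructure E M k) (x : M) (v : TangentSpace 𝓘(ℝ, E) x) :
    Submodule ℝ (TangentSpace 𝓘(ℝ, E) x) :=
  S.D x ⊔ Submodule.span ℝ {u | ∃ X Y : (y : M) → TangentSpace 𝓘(ℝ, E) y,
    SectionNear S.D X x ∧ SectionNear S.D Y x ∧ X x = v ∧
      u = VectorField.mlieBracket 𝓘(ℝ, E) X Y x}

/-- `γ` is a section of `D^0` along `σ` with `∇^T γ = - T^B(dσ/dt, L_L(dσ/dt))`, and `γ t`
annihilates `D + [dσ/dt, D]` at `σ t` for all `t`. -/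
def IsComparisonSection (S : NonholonomicStructure E M k)
    (g : ContMDiffRiemannianMetric 𝓘(ℝ, E) ∞ E (fun x : M => TangentSpace 𝓘(ℝ, E) x))
    (σ : ℝ → M) (γ : (t : ℝ) → TangentSpace 𝓘(ℝ, E) (σ t) →L[ℝ] ℝ) : Prop :=
  IsAnnihilatorSection S σ γ ∧
  (∀ t ∈ Icc (0 : ℝ) 1, ∃ β : TangentSpace 𝓘(ℝ, E) (σ t) →L[ℝ] ℝ,
    HasTB S g σ (momentum S g σ) t β ∧ HasNablaT S g σ γ t (-β)) ∧
  ∀ t ∈ Icc (0 : ℝ) 1, ∀ u ∈ bracketSpan S (σ t) (velocity σ t), γ t u = 0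

end SubFinsler

end

/-! Write λ for the momentum `L_L(dσ/dt)`, v for the velocity and δγ for `i_X dγ` with X extending
v. In the chart at `σ t` the theorem reduces to one pointwise fact: wherever the Barthel derivative
of λ exists, λ + γ satisfies the sub-Hamiltonian equations if and only if δγ = -∇^B λ
(`hasDerivWithinAt_momentum_add_iff`). Three computations give it.

Barthel side: Euler's relations for the 2-homogeneous extended Lagrangian give λ ∘ N = ∂L/∂x
(`fderiv_comp_fderiv_sprayOf`), so the spray disappears and ∇^B λ = dλ/dt - ∂L/∂x. Hamiltonian side:
η is the fibrewise Fenchel conjugate of L on D, with p(u) ≤ η(p) + L(u) for u in D and equality when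
p restricts to the Legendre transform of u. Minimality of the gap gives ∂η/∂p = v and ∂η/∂x =
γ(∂P/∂x v) - ∂L/∂x at λ + γ (`fderiv_dualEnergy_right`, `fderiv_dualEnergy_left`). Bracket side:
differentiating X = P X and applying γ, which kills D, gives γ(∂X) = γ(∂P v), hence δγ = dγ/dt +
γ(∂P v) (`hasDelta_iff`).

Now split δγ = -∇^B λ along T^*M = D^0 ⊕ D^*. The D^0 part says ∇^T γ = -T^B. For sections Y of D
the function γ(Y) vanishes along σ, so δγ(Y) = -γ([X, Y]), and δγ vanishes on D exactly when γ
annihilates D + [v, D] (`HasDelta.comp_proj_eq_zero_iff`). Therefore any two of "σ is free", "γ is a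
multiplier" and (∗) imply the third. Existence of a multiplier is automatic for a normal extremal:
∂η/∂p = v determines the lift on D (`comp_projCoord_of_fderiv_hamiltonianCoord`).

Smoothness of F fails at v = 0; there homogeneity and minimality make the relevant derivatives zero.
-/

noncomputable section

namespace SubFinsler

/-! ### Fenchel duality in a single tangent space. -/

section Fiber

variable {V : Type*} [NormedAddCommGroup V] [NormedSpace ℝ V]

/-- An energy function on `V` that splits as the energy of a Minkowski norm on the range of the
projection `P` and a positive 2-homogeneous function on its kernel. -/
structure IsSplitEnergy (P : V →L[ℝ] V) (L : V → ℝ) : Prop where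
  idem : ∀ w, P (P w) = P w
  homog : ∀ (c : ℝ) w, L (c • w) = c ^ 2 * L w
  pos : ∀ w, w ≠ 0 → 0 < L w
  split : ∀ w, L w = L (P w) + L (w - P w)
  smooth : ∀ w, P w ≠ 0 → ContDiffAt ℝ ∞ L w
  hess : ∀ w, P w = w → w ≠ 0 → ∀ y, y ≠ 0 → 0 < fderiv ℝ (fderiv ℝ L) w y y

/-- Half the squared dual norm of a covector, with respect to the unit vectors for the energy `L` in
the range of the projection `P`. -/
def dualEnergy (P : V →L[ℝ] V) (L : V → ℝ) (p : V →L[ℝ] ℝ) : ℝ :=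
  (1 / 2 : ℝ) * sSup {r | ∃ v, P v = v ∧ L v = 1 / 2 ∧ r = p v} ^ 2

theorem dualEnergy_of_comp_proj_eq_zero {P : V →L[ℝ] V} {L : V → ℝ} {p : V →L[ℝ] ℝ}
    (hp : p.comp P = 0) :
    dualEnergy P L p = 0 := by
  have hsub : {r | ∃ v, P v = v ∧ L v = 1 / 2 ∧ r = p v} ⊆ {0} := by
    rintro r ⟨v, hv, -, rfl⟩
    have := DFunLike.congr_fun hp v
    simpa [hv] using this
  -- The set of values may be empty; `sSup ∅ = 0` in `ℝ`, so both cases agree.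
  rcases subset_singleton_iff_eq.1 hsub with h0 | h0 <;>
    rw [dualEnergy, h0] <;> simp

/-- On each line through 0 the function is `s ^ 2 * L y`, stationary at 0; without differentiability
the default value of `fderiv` is 0 as well. This handles zero velocity. -/
theorem fderiv_zero_of_homogeneous {L : V → ℝ} (h : ∀ (c : ℝ) w, L (c • w) = c ^ 2 * L w) :
    fderiv ℝ L 0 = 0 := by
  by_cases hd : DifferentiableAt ℝ L 0
  · ext y
    have h1 : HasDerivAt (fun s : ℝ => L (s • y)) (fderiv ℝ L 0 y) 0 := by
      have h2 : HasFDerivAt L (fderiv ℝ L 0) ((0 : ℝ) • y) := by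
        rw [zero_smul]; exact hd.hasFDerivAt
      simpa [Function.comp_def] using h2.comp_hasDerivAt (0 : ℝ) ((hasDerivAt_id (0 : ℝ)).smul_const y)
    have h3 : HasDerivAt (fun s : ℝ => L (s • y)) 0 0 := by
      simp only [h]
      simpa using ((hasDerivAt_id (0 : ℝ)).pow 2).mul_const (L y)
    simpa using h1.unique h3
  · exact fderiv_zero_of_not_differentiableAt hd

theorem fderiv_apply_self_of_homogeneous {L : V → ℝ}
    (h : ∀ (c : ℝ) w, L (c • w) = c ^ 2 * L w) {w : V} (hd : DifferentiableAt ℝ L w) :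
    fderiv ℝ L w w = 2 * L w := by
  have h1 : HasDerivAt (fun s : ℝ => L (s • w)) (fderiv ℝ L w w) 1 := by
    have h2 : HasFDerivAt L (fderiv ℝ L w) ((1 : ℝ) • w) := by
      rw [one_smul]; exact hd.hasFDerivAt
    simpa [Function.comp_def] using h2.comp_hasDerivAt (1 : ℝ) ((hasDerivAt_id (1 : ℝ)).smul_const w)
  have h3 : HasDerivAt (fun s : ℝ => L (s • w)) (2 * L w) 1 := by
    simp only [h]
    simpa using ((hasDerivAt_id (1 : ℝ)).pow 2).mul_const (L w)
  exact h1.unique h3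

theorem hasDerivAt_line {L : V → ℝ} {w y : V} {s : ℝ} (hd : DifferentiableAt ℝ L (w + s • y)) :
    HasDerivAt (fun s : ℝ => L (w + s • y)) (fderiv ℝ L (w + s • y) y) s := by
  have h := hd.hasFDerivAt.comp_hasDerivAt s
    (((hasDerivAt_id s).smul_const y).const_add w)
  simpa [Function.comp_def] using h

namespace IsSplitEnergy

variable {P : V →L[ℝ] V} {L : V → ℝ} (h : IsSplitEnergy P L)
include h

theorem map_zero : L 0 = 0 := by simpa using h.homog 0 0

theorem nonneg (w : V) : 0 ≤ L w := by
  rcases eq_or_ne w 0 with rfl | hw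
  · rw [h.map_zero]
  · exact (h.pos w hw).le

theorem differentiableAt {w : V} (hw : P w ≠ 0) : DifferentiableAt ℝ L w :=
  (h.smooth w hw).differentiableAt (by simp)

theorem apply_add_ker (w y : V) (hy : P y = 0) (hw : P w = w) : L (w + y) = L w + L y := by
  rw [h.split (w + y)]; simp [hy, hw]

/-- In a kernel direction y the energy is `L w + s ^ 2 * L y`, stationary at `s = 0`. -/
theorem fderiv_comp_proj {w : V} (hw : P w = w) (hw0 : w ≠ 0) :
    (fderiv ℝ L w).comp P = fderiv ℝ L w := by
  ext y
  have hd : DifferentiableAt ℝ L (w + (0 : ℝ) • (y - P y)) := by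
    simpa using h.differentiableAt (by rwa [hw])
  have h1 := hasDerivAt_line hd
  have h3 : HasDerivAt (fun s : ℝ => L (w + s • (y - P y))) 0 0 := by
    have : (fun s : ℝ => L (w + s • (y - P y))) = fun s => L w + s ^ 2 * L (y - P y) := by
      funext s
      rw [h.apply_add_ker _ _ (by simp [h.idem]) hw, h.homog]
    rw [this]
    simpa using (((hasDerivAt_id (0 : ℝ)).pow 2).mul_const (L (y - P y))).const_add (L w)
  have := h1.unique h3
  simp only [zero_smul, add_zero, map_sub] at this
  simp only [ContinuousLinearMap.comp_apply]
  linarith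

/-- The derivative of `L` at `w` in the direction `w - P w` is `2 * L (w - P w)`, which is positive
unless `w = P w`. -/
theorem mem_range_of_fderiv_comp_proj {w : V} (hw : P w ≠ 0)
    (hl : (fderiv ℝ L w).comp P = fderiv ℝ L w) : P w = w := by
  by_contra hne
  have hd : DifferentiableAt ℝ L (w + (0 : ℝ) • (w - P w)) := by
    simpa using h.differentiableAt hw
  have h1 := hasDerivAt_line hd
  have h3 : HasDerivAt (fun s : ℝ => L (w + s • (w - P w))) (2 * L (w - P w)) 0 := by
    have : (fun s : ℝ => L (w + s • (w - P w))) =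
        fun s => L (P w) + (1 + s) ^ 2 * L (w - P w) := by
      funext s
      rw [h.split, ← h.homog]
      congr 2
      · simp [h.idem]
      · simp only [map_add, map_smul, map_sub, h.idem, sub_self, smul_zero, add_zero]
        module
    rw [this]
    simpa using ((((hasDerivAt_id (0 : ℝ)).const_add 1).pow 2).mul_const (L (w - P w))).const_add
      (L (P w))
  have := h1.unique h3
  have hl' := DFunLike.congr_fun hl w
  simp only [ContinuousLinearMap.comp_apply] at hl'
  simp only [zero_smul, add_zero, map_sub, hl', sub_self] at this
  have := h.pos (w - P w) (sub_ne_zero.2 (Ne.symm hne))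
  linarith

/-- The tangent inequality of a convex function. If the line through `w` and `u` avoids 0, the
Hessian gives convexity along it; otherwise `u = c • w` and homogeneity reduces the claim to `0 ≤ (c
- 1) ^ 2 * L w`. -/
theorem le_of_fderiv {w u : V} (hw : P w = w) (hw0 : w ≠ 0) (hu : P u = u) :
    L w + fderiv ℝ L w (u - w) ≤ L u := by
  have heul := fderiv_apply_self_of_homogeneous h.homog (h.differentiableAt (w := w) (by rwa [hw]))
  by_cases hc : ∃ s : ℝ, w + s • (u - w) = 0
  · obtain ⟨s, hs⟩ := hc
    have hs0 : s ≠ 0 := by rintro rfl; simp at hs; exact hw0 hs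
    have hu' : u = (1 - s⁻¹) • w := by
      have : s • u = (s - 1) • w := by
        have : w + s • (u - w) = s • u - (s - 1) • w := by module
        rw [this] at hs
        exact sub_eq_zero.1 hs
      calc u = s⁻¹ • (s • u) := by rw [smul_smul, inv_mul_cancel₀ hs0, one_smul]
        _ = _ := by rw [this, smul_smul]; congr 1; field_simp
    rw [map_sub, hu', map_smul, heul, h.homog, smul_eq_mul]
    nlinarith [h.nonneg w, mul_nonneg (sq_nonneg (s⁻¹)) (h.nonneg w)]
  · push Not at hc
    have hD : ∀ s : ℝ, P (w + s • (u - w)) = w + s • (u - w) := by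
      intro s; simp [hw, hu]
    have hP : ∀ s : ℝ, P (w + s • (u - w)) ≠ 0 := fun s => by rw [hD]; exact hc s
    have h1 : ∀ s : ℝ, HasDerivAt (fun s : ℝ => L (w + s • (u - w)))
        (fderiv ℝ L (w + s • (u - w)) (u - w)) s :=
      fun s => hasDerivAt_line (h.differentiableAt (hP s))
    have h2 : ∀ s : ℝ, HasDerivAt (fun s : ℝ => fderiv ℝ L (w + s • (u - w)) (u - w))
        (fderiv ℝ (fderiv ℝ L) (w + s • (u - w)) (u - w) (u - w)) s := by
      intro s
      have hd : DifferentiableAt ℝ (fderiv ℝ L) (w + s • (u - w)) :=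
        ((h.smooth _ (hP s)).fderiv_right (m := 1) (by norm_cast)).differentiableAt (by simp)
      have h3 := hd.hasFDerivAt.comp_hasDerivAt s
        (((hasDerivAt_id s).smul_const (u - w)).const_add w)
      have h4 := h3.clm_apply (hasDerivAt_const s (u - w))
      simpa using h4
    have hconv : ConvexOn ℝ univ (fun s : ℝ => L (w + s • (u - w))) := by
      apply MonotoneOn.convexOn_of_deriv convex_univ
      · exact fun s _ => (h1 s).continuousAt.continuousWithinAt
      · exact fun s _ => (h1 s).differentiableAt.differentiableWithinAt
      · have : deriv (fun s : ℝ => L (w + s • (u - w))) =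
            fun s => fderiv ℝ L (w + s • (u - w)) (u - w) := funext fun s => (h1 s).deriv
        rw [this]
        have hmono : Monotone (fun s : ℝ => fderiv ℝ L (w + s • (u - w)) (u - w)) := by
          apply monotone_of_deriv_nonneg (fun s => (h2 s).differentiableAt)
          intro s
          rw [(h2 s).deriv]
          rcases eq_or_ne (u - w) 0 with h0 | h0
          · simp [h0]
          · exact (h.hess _ (hD s) (hc s) _ h0).le
        exact hmono.monotoneOn _
    have := hconv.le_slope_of_hasDerivAt (mem_univ (0 : ℝ)) (mem_univ (1 : ℝ)) one_pos (h1 0)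
    simp [slope_def_field] at this
    rw [map_sub]
    linarith

/-- Fenchel–Young: in the tangent inequality, Euler's relation replaces `fderiv ℝ L w w` by `2 * L
w`. -/
theorem apply_le_of_comp_proj_eq {w u : V} (hw : P w = w) (hw0 : w ≠ 0) (hu : P u = u)
    {p : V →L[ℝ] ℝ} (hp : p.comp P = fderiv ℝ L w) : p u ≤ L w + L u := by
  have heul := fderiv_apply_self_of_homogeneous h.homog (h.differentiableAt (w := w) (by rwa [hw]))
  have h1 := h.le_of_fderiv hw hw0 hu
  have h2 := DFunLike.congr_fun hp u
  simp only [ContinuousLinearMap.comp_apply, hu] at h2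
  rw [map_sub] at h1
  linarith

/-- The supremum is `m = √(2 * L w)`, the norm of `w`, attained at the unit vector `m⁻¹ • w`;
Fenchel–Young at `m • v` gives the upper bound. -/
theorem dualEnergy_of_comp_proj_eq {w : V} (hw : P w = w) (hw0 : w ≠ 0)
    {p : V →L[ℝ] ℝ} (hp : p.comp P = fderiv ℝ L w) : dualEnergy P L p = L w := by
  have heul := fderiv_apply_self_of_homogeneous h.homog (h.differentiableAt (w := w) (by rwa [hw]))
  have hpw : p w = 2 * L w := by
    rw [← heul, ← hp]; simp [hw]
  have hLpos := h.pos w hw0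
  set m := √(2 * L w) with hm
  have hmpos : 0 < m := Real.sqrt_pos.2 (by linarith)
  have hm2 : m ^ 2 = 2 * L w := Real.sq_sqrt (by linarith)
  have hg : IsGreatest {r | ∃ v, P v = v ∧ L v = 1 / 2 ∧ r = p v} m := by
    constructor
    · refine ⟨m⁻¹ • w, by simp [hw], ?_, ?_⟩
      · rw [h.homog, inv_pow, hm2]; field_simp
      · rw [map_smul, hpw, ← hm2, smul_eq_mul]; field_simp
    · rintro r ⟨v, hv, hLv, rfl⟩
      have := h.apply_le_of_comp_proj_eq hw hw0 (u := m • v) (by simp [hv]) hp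
      rw [map_smul, h.homog, hLv, smul_eq_mul] at this
      have : m * p v ≤ m * m := by nlinarith
      exact le_of_mul_le_mul_left this hmpos
  rw [dualEnergy, hg.csSup_eq, hm2]; ring

/-- Surjectivity of the Legendre map of the range of `P`: a maximiser of the scale-invariant
quotient `p u ^ 2 / (2 * L u)`, suitably rescaled, minimises `L - p` on the range, and the
first-order condition is the claim. -/
theorem exists_comp_proj_eq_fderiv [FiniteDimensional ℝ V] {p : V →L[ℝ] ℝ} (hp : p.comp P ≠ 0) :
    ∃ w, P w = w ∧ w ≠ 0 ∧ p.comp P = fderiv ℝ L w := by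
  set K : Set V := {u | P u = u} ∩ Metric.sphere 0 1 with hK
  have hKc : IsCompact K := by
    refine (isCompact_sphere (0 : V) 1).inter_left ?_
    exact isClosed_eq P.continuous continuous_id
  have hK0 : ∀ u ∈ K, u ≠ 0 := by
    rintro u ⟨-, hu⟩ rfl
    simp at hu
  obtain ⟨y, hy⟩ : ∃ y, p (P y) ≠ 0 := by
    by_contra! hc
    exact hp (by ext y; simpa using hc y)
  have hnorm : ∀ u, P u = u → u ≠ 0 → ‖u‖⁻¹ • u ∈ K := by
    intro u hu hu0
    refine ⟨by simp [hu], ?_⟩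
    simp [norm_smul, hu0]
  have hy0 : P y ≠ 0 := fun h0 => hy (by simp [h0])
  have hcont : ContinuousOn (fun u => p u ^ 2 / (2 * L u)) K := by
    intro u hu
    have : ContinuousAt L u := (h.differentiableAt (by rw [hu.1]; exact hK0 u hu)).continuousAt
    refine (ContinuousAt.div (by fun_prop) (by fun_prop) ?_).continuousWithinAt
    have := h.pos u (hK0 u hu)
    positivity
  obtain ⟨u, huK, hmax⟩ := hKc.exists_isMaxOn ⟨_, hnorm (P y) (h.idem y) hy0⟩ hcont
  have hu0 := hK0 u huK
  have hLu := h.pos u hu0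
  have hbound : ∀ v, P v = v → v ≠ 0 → p v ^ 2 / (2 * L v) ≤ p u ^ 2 / (2 * L u) := by
    intro v hv hv0
    have h1 := hmax (hnorm v hv hv0)
    simp only [mem_ofPred_eq, map_smul, h.homog, smul_eq_mul] at h1
    refine le_trans (le_of_eq ?_) h1
    have hn : ‖v‖ ≠ 0 := norm_ne_zero_iff.2 hv0
    have := (h.pos v hv0).ne'
    field_simp
  have hpu : p u ≠ 0 := by
    intro h0
    have h1 := hbound (P y) (h.idem y) hy0
    rw [h0] at h1
    have := h.pos _ hy0
    have : 0 < p (P y) ^ 2 / (2 * L (P y)) := by positivity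
    simp at h1; linarith
  -- The critical point of `c ↦ L (c • u) - p (c • u)`; the value there is `-c ^ 2 * L u`.
  set c : ℝ := p u / (2 * L u) with hc
  have hc0 : c ≠ 0 := by positivity
  have hw0 : c • u ≠ 0 := smul_ne_zero hc0 hu0
  have hPw : P (c • u) = c • u := by rw [map_smul, huK.1]
  refine ⟨c • u, hPw, hw0, ?_⟩
  have hmin : ∀ v, P v = v → 0 ≤ L v - p v + c ^ 2 * L u := by
    intro v hv
    rcases eq_or_ne v 0 with rfl | hv0
    · simp [h.map_zero]; positivity
    · have h1 := hbound v hv hv0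
      have hLv := h.pos v hv0
      have h2 : p u ^ 2 / (2 * L u) = 2 * (c ^ 2 * L u) := by rw [hc]; field_simp
      rw [h2, div_le_iff₀ (by linarith)] at h1
      have h4 : 0 ≤ c ^ 2 * L u := by positivity
      by_contra! hneg
      -- This contradicts `p v ^ 2 ≤ 4 * L v * (c ^ 2 * L u) ≤ (L v + c ^ 2 * L u) ^ 2`, maximality
      -- followed by the inequality of means.
      have : (L v + c ^ 2 * L u) ^ 2 < p v ^ 2 := by
        apply pow_lt_pow_left₀ (by linarith) (by positivity) (by norm_num)
      nlinarith [sq_nonneg (L v - c ^ 2 * L u)]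
  rw [← h.fderiv_comp_proj hPw hw0]
  have hd : DifferentiableAt ℝ L (c • u) := h.differentiableAt (by rwa [hPw])
  ext y
  have h1 : HasDerivAt (fun s : ℝ => L (c • u + s • P y) - p (c • u + s • P y) + c ^ 2 * L u)
      (fderiv ℝ L (c • u) (P y) - p (P y)) 0 := by
    have ha := hasDerivAt_line (L := L) (w := c • u) (y := P y) (s := 0) (by simpa using hd)
    have hb := hasDerivAt_line (L := p) (w := c • u) (y := P y) (s := 0) p.differentiableAt
    simpa using (ha.sub hb).add_const (c ^ 2 * L u)
  have h2 : IsLocalMin (fun s : ℝ => L (c • u + s • P y) - p (c • u + s • P y) + c ^ 2 * L u) 0 := by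
    refine Eventually.of_forall fun s => ?_
    have h3 : L (c • u + (0 : ℝ) • P y) - p (c • u + (0 : ℝ) • P y) + c ^ 2 * L u = 0 := by
      simp only [zero_smul, add_zero, h.homog, map_smul, smul_eq_mul]
      rw [hc]; field_simp; ring
    simp only [h3]
    exact hmin _ (by rw [map_add, hPw, map_smul, h.idem])
  have h4 := h2.hasDerivAt_eq_zero h1
  simp only [ContinuousLinearMap.comp_apply]
  linarith

theorem apply_le_dualEnergy_add [FiniteDimensional ℝ V] (p : V →L[ℝ] ℝ) {u : V} (hu : P u = u) :
    p u ≤ dualEnergy P L p + L u := by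
  by_cases hp : p.comp P = 0
  · have h1 := DFunLike.congr_fun hp u
    simp only [ContinuousLinearMap.comp_apply, hu, zero_apply] at h1
    rw [h1, dualEnergy_of_comp_proj_eq_zero hp, zero_add]
    exact h.nonneg u
  · obtain ⟨w, hw, hw0, hpw⟩ := h.exists_comp_proj_eq_fderiv hp
    rw [h.dualEnergy_of_comp_proj_eq hw hw0 hpw]
    exact h.apply_le_of_comp_proj_eq hw hw0 hu hpw

end IsSplitEnergy

end Fiber

/-! ### Derivatives of the spray and of the dual energy when the base point varies. -/

section Family

variable {E : Type*} [NormedAddCommGroup E] [NormedSpace ℝ E]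

/-- A family of split energies, smooth in the base point near `z₀` away from the kernel of the
projection. -/
structure IsSplitEnergyFamily (P : E → E →L[ℝ] E) (L : E → E → ℝ) (z₀ : E) : Prop where
  fiber : ∀ᶠ z in 𝓝 z₀, IsSplitEnergy (P z) (L z)
  smooth_proj : ContDiffAt ℝ ∞ P z₀
  smooth : ∀ w, P z₀ w ≠ 0 → ContDiffAt ℝ ∞ (Function.uncurry L) (z₀, w)

/-- The spray coefficients of a Lagrangian on a vector space. -/
def sprayOf (L : E → E → ℝ) (z v : E) : E :=
  (fderiv ℝ (fun u : E => fderiv ℝ (L z) u) v).inverse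
    (fderiv ℝ (fun y : E => fderiv ℝ (L y) v) z v - fderiv ℝ (fun y : E => L y v) z)

theorem contDiffAt_fderiv_right_variable {L : E → E → ℝ} {z v : E}
    (h : ContDiffAt ℝ ∞ (Function.uncurry L) (z, v)) :
    ContDiffAt ℝ ∞ (fun q : E × E => fderiv ℝ (L q.1) q.2) (z, v) := by
  refine ContDiffAt.fderiv (n := ∞) (f := fun q : E × E => L q.1) (g := Prod.snd) ?_
    contDiffAt_snd le_rfl
  exact ContDiffAt.comp (g := Function.uncurry L)
    (f := fun q : (E × E) × E => (q.1.1, q.2)) ((z, v), v) h (by fun_prop)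

theorem contDiffAt_fderiv_left_variable {L : E → E → ℝ} {z v : E}
    (h : ContDiffAt ℝ ∞ (Function.uncurry L) (z, v)) :
    ContDiffAt ℝ ∞ (fun u : E => fderiv ℝ (fun y => L y u) z) v := by
  refine ContDiffAt.fderiv (n := ∞) (f := fun u y : E => L y u) (g := fun _ => z) ?_
    contDiffAt_const le_rfl
  exact ContDiffAt.comp (g := Function.uncurry L)
    (f := fun q : E × E => (q.2, q.1)) (v, z) h (by fun_prop)

theorem contDiffAt_fderiv_mixed {L : E → E → ℝ} {z v : E}
    (h : ContDiffAt ℝ ∞ (Function.uncurry L) (z, v)) :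
    ContDiffAt ℝ ∞ (fun u : E => fderiv ℝ (fun y => fderiv ℝ (L y) u) z) v := by
  refine ContDiffAt.fderiv (n := ∞) (f := fun u y : E => fderiv ℝ (L y) u) (g := fun _ => z) ?_
    contDiffAt_const le_rfl
  exact ContDiffAt.comp (g := fun q : E × E => fderiv ℝ (L q.1) q.2)
    (f := fun q : E × E => (q.2, q.1)) (v, z) (contDiffAt_fderiv_right_variable h) (by fun_prop)

theorem contDiffAt_of_uncurry_left {L : E → E → ℝ} {z v : E}
    (h : ContDiffAt ℝ ∞ (Function.uncurry L) (z, v)) : ContDiffAt ℝ ∞ (L z) v :=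
  ContDiffAt.comp (g := Function.uncurry L) (f := fun u : E => (z, u)) v h (by fun_prop)

theorem contDiffAt_of_uncurry_right {L : E → E → ℝ} {z v : E}
    (h : ContDiffAt ℝ ∞ (Function.uncurry L) (z, v)) : ContDiffAt ℝ ∞ (fun y => L y v) z :=
  ContDiffAt.comp (g := Function.uncurry L) (f := fun y : E => (y, v)) z h (by fun_prop)

theorem two_le_infty : minSmoothness ℝ 2 ≤ (∞ : WithTop ℕ∞) := by
  rw [minSmoothness_of_isRCLikeNormedField]
  exact WithTop.coe_le_coe.2 le_top

/-- The mixed second partial derivatives of a function of two variables agree. -/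
theorem fderiv_fderiv_mixed_comm {L : E → E → ℝ} {z v : E}
    (h : ContDiffAt ℝ ∞ (Function.uncurry L) (z, v)) (x w : E) :
    fderiv ℝ (fun u : E => fderiv ℝ (fun y => L y u) z) v w x =
      fderiv ℝ (fun y => fderiv ℝ (L y) v) z x w := by
  set f := Function.uncurry L with hf
  have hdf : ContDiffAt ℝ ∞ (fderiv ℝ f) (z, v) := h.fderiv_right le_rfl
  have hdd : HasFDerivAt (fderiv ℝ f) (fderiv ℝ (fderiv ℝ f) (z, v)) (z, v) :=
    (hdf.differentiableAt (by simp)).hasFDerivAt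
  have hev : ∀ᶠ q in 𝓝 (z, v), DifferentiableAt ℝ f q :=
    (((h.of_le (m := 1) (by simp)).eventually (by simp)).mono fun q hq =>
      hq.differentiableAt (by simp))
  have hsymm : IsSymmSndFDerivAt ℝ f (z, v) := h.isSymmSndFDerivAt two_le_infty
  have h1 : (fun u : E => fderiv ℝ (fun y => L y u) z) =ᶠ[𝓝 v]
      fun u => (fderiv ℝ f (z, u)).comp (ContinuousLinearMap.inl ℝ E E) := by
    have : Tendsto (fun u : E => (z, u)) (𝓝 v) (𝓝 (z, v)) := by
      apply Continuous.tendsto; fun_prop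
    filter_upwards [this.eventually hev] with u hu
    exact (hu.hasFDerivAt.comp z (f := fun y => (y, u)) (hasFDerivAt_prodMk_left z u)).fderiv
  have h2 : (fun y : E => fderiv ℝ (L y) v) =ᶠ[𝓝 z]
      fun y => (fderiv ℝ f (y, v)).comp (ContinuousLinearMap.inr ℝ E E) := by
    have : Tendsto (fun y : E => (y, v)) (𝓝 z) (𝓝 (z, v)) := by
      apply Continuous.tendsto; fun_prop
    filter_upwards [this.eventually hev] with y hy
    exact (hy.hasFDerivAt.comp v (hasFDerivAt_prodMk_right y v)).fderiv
  have h3 := (hdd.comp v (hasFDerivAt_prodMk_right z v)).clm_comp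
    (hasFDerivAt_const (ContinuousLinearMap.inl ℝ E E) v)
  have h4 := (hdd.comp z (f := fun y => (y, v)) (hasFDerivAt_prodMk_left z v)).clm_comp
    (hasFDerivAt_const (ContinuousLinearMap.inr ℝ E E) z)
  rw [(h3.congr_of_eventuallyEq h1).fderiv, (h4.congr_of_eventuallyEq h2).fderiv]
  simpa using hsymm (0, w) (x, 0)

theorem finrank_clm_dual [FiniteDimensional ℝ E] :
    Module.finrank ℝ (E →L[ℝ] ℝ) = Module.finrank ℝ E := by
  rw [← (LinearMap.toContinuousLinearMap (𝕜 := ℝ) (E := E) (F' := ℝ)).finrank_eq]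
  exact Subspace.dual_finrank_eq

theorem isInvertible_of_pos [FiniteDimensional ℝ E] {H : E →L[ℝ] E →L[ℝ] ℝ}
    (hH : ∀ y, y ≠ 0 → 0 < H y y) : H.IsInvertible := by
  have hinj : Function.Injective (H : E →ₗ[ℝ] E →L[ℝ] ℝ) := by
    rw [← LinearMap.ker_eq_bot, LinearMap.ker_eq_bot']
    intro y hy
    by_contra h0
    have h1 := hH y h0
    have h2 : H y = 0 := hy
    rw [h2] at h1; simp at h1
  refine ⟨(LinearMap.linearEquivOfInjective _ hinj finrank_clm_dual.symm).toContinuousLinearEquiv, ?_⟩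
  ext; simp

namespace IsSplitEnergyFamily

variable {P : E → E →L[ℝ] E} {L : E → E → ℝ} {z₀ : E} (h : IsSplitEnergyFamily P L z₀)
include h

theorem at_base : IsSplitEnergy (P z₀) (L z₀) := h.fiber.self_of_nhds

theorem continuousAt_proj : ContinuousAt P z₀ := h.smooth_proj.continuousAt

theorem eventually_proj_ne_zero {w : E} (hw : P z₀ w ≠ 0) :
    ∀ᶠ q : E × E in 𝓝 (z₀, w), P q.1 q.2 ≠ 0 := by
  have : ContinuousAt (fun q : E × E => P q.1 q.2) (z₀, w) := by
    have h1 : ContinuousAt (fun q : E × E => P q.1) (z₀, w) :=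
      ContinuousAt.comp (g := P) h.continuousAt_proj continuousAt_fst
    exact h1.clm_apply continuousAt_snd
  exact this.eventually_ne hw

/-- With λ = ∂L/∂v, this is λ ∘ N = ∂L/∂x. Euler's relations turn the definition of the spray G into
λ(G) = ∂L/∂x (u) for `u` near `v`; differentiating in `u` and using symmetry of second derivatives
leaves λ(∂G) = 2 ∂L/∂x. -/
theorem fderiv_comp_fderiv_sprayOf [FiniteDimensional ℝ E] {v : E} (hv : P z₀ v = v) :
    (fderiv ℝ (L z₀) v).comp ((1 / 2 : ℝ) • fderiv ℝ (sprayOf L z₀) v) =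
      fderiv ℝ (fun y => L y v) z₀ := by
  have := FiniteDimensional.complete ℝ E
  rcases eq_or_ne v 0 with rfl | hv0
  -- At `v = 0` both sides vanish, whatever value the derivative of the spray has there.
  · rw [fderiv_zero_of_homogeneous h.at_base.homog, ContinuousLinearMap.zero_comp]
    have : (fun y => L y 0) =ᶠ[𝓝 z₀] fun _ => (0 : ℝ) := h.fiber.mono fun z hz => hz.map_zero
    rw [this.fderiv_eq]; simp
  have hs := h.smooth v (by rwa [hv])
  set lam : E → E →L[ℝ] ℝ := fun u => fderiv ℝ (L z₀) u with hlam
  set H : E → E →L[ℝ] E →L[ℝ] ℝ := fun u => fderiv ℝ lam u with hH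
  set B : E → E →L[ℝ] E →L[ℝ] ℝ := fun u => fderiv ℝ (fun y => fderiv ℝ (L y) u) z₀ with hB
  set C : E → E →L[ℝ] ℝ := fun u => fderiv ℝ (fun y => L y u) z₀ with hC
  have hsz : ContDiffAt ℝ ∞ (L z₀) v := contDiffAt_of_uncurry_left hs
  have slam : ContDiffAt ℝ ∞ lam v := hsz.fderiv_right le_rfl
  have sH : ContDiffAt ℝ ∞ H v := slam.fderiv_right le_rfl
  have sB : ContDiffAt ℝ ∞ B v := contDiffAt_fderiv_mixed hs
  have sC : ContDiffAt ℝ ∞ C v := contDiffAt_fderiv_left_variable hs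
  obtain ⟨e, he⟩ : (H v).IsInvertible := isInvertible_of_pos (h.at_base.hess v hv hv0)
  have sG : ContDiffAt ℝ ∞ (sprayOf L z₀) v := by
    have h1 : ContDiffAt ℝ ∞ (fun u => (H u).inverse) v := by
      refine ContDiffAt.comp (g := ContinuousLinearMap.inverse) v ?_ sH
      rw [← he]; exact contDiffAt_map_inverse e
    exact h1.clm_apply ((sB.clm_apply contDiffAt_id).sub sC)
  have hHG : ∀ᶠ u in 𝓝 v, H u (sprayOf L z₀ u) = B u u - C u := by
    have h1 : range ((↑) : (E ≃L[ℝ] (E →L[ℝ] ℝ)) → E →L[ℝ] (E →L[ℝ] ℝ)) ∈ 𝓝 (H v) := by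
      rw [← he]; exact ContinuousLinearEquiv.nhds e
    filter_upwards [sH.continuousAt h1] with u hu
    obtain ⟨e', he'⟩ := hu
    change H u ((H u).inverse (B u u - C u)) = _
    rw [← he']; simp
  have hne : ∀ᶠ u in 𝓝 v, P z₀ u ≠ 0 := by
    have h1 : ContinuousAt (fun u => P z₀ u) v := by fun_prop
    exact h1.eventually_ne (by rwa [hv])
  have heul : ∀ᶠ u in 𝓝 v, lam u u = 2 * L z₀ u := hne.mono fun u hu =>
    fderiv_apply_self_of_homogeneous h.at_base.homog (h.at_base.differentiableAt hu)
  -- The derivative in `u` of Euler's relation; `hBC` is its derivative in the base point.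
  have hHu : ∀ᶠ u in 𝓝 v, ∀ w, H u w u = lam u w := by
    filter_upwards [heul.eventually_nhds, hne] with u hu hPu w
    have hsu := h.at_base.smooth u hPu
    have h1 := ((hsu.fderiv_right (m := ∞) le_rfl).differentiableAt (by simp)).hasFDerivAt.clm_apply
      (hasFDerivAt_id u)
    have h2 : HasFDerivAt (fun u => lam u u) ((2 : ℝ) • lam u) u :=
      ((hsu.differentiableAt (by simp)).hasFDerivAt.const_mul 2).congr_of_eventuallyEq hu
    have h3 := DFunLike.congr_fun (h1.unique h2) w
    simp at h3
    change H u w u = lam u w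
    change lam u w + H u w u = 2 * lam u w at h3
    linarith
  have hBC : ∀ᶠ u in 𝓝 v, ∀ w, B u w u = 2 * C u w := by
    filter_upwards [hne] with u hPu w
    have hsu := h.smooth u hPu
    have h1 : HasFDerivAt (fun y => fderiv ℝ (L y) u) (B u) z₀ := by
      refine DifferentiableAt.hasFDerivAt ?_
      have := contDiffAt_fderiv_right_variable hsu
      exact (ContDiffAt.comp (g := fun q : E × E => fderiv ℝ (L q.1) q.2)
        (f := fun y : E => (y, u)) z₀ this (by fun_prop)).differentiableAt (n := ∞) (by simp)
    have h2 := h1.clm_apply (hasFDerivAt_const u z₀)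
    have h3 : HasFDerivAt (fun y => L y u) (C u) z₀ :=
      ((contDiffAt_of_uncurry_right hsu).differentiableAt (by simp)).hasFDerivAt
    have h4 : (fun y => fderiv ℝ (L y) u u) =ᶠ[𝓝 z₀] fun y => 2 * L y u := by
      have : Tendsto (fun y : E => (y, u)) (𝓝 z₀) (𝓝 (z₀, u)) := by
        apply Continuous.tendsto; fun_prop
      filter_upwards [h.fiber, this.eventually (h.eventually_proj_ne_zero hPu)] with y hy hyu
      exact fderiv_apply_self_of_homogeneous hy.homog (hy.differentiableAt hyu)
    have h5 := DFunLike.congr_fun (h2.unique ((h3.const_mul 2).congr_of_eventuallyEq h4)) w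
    simpa using h5
  have hphi : (fun u => lam u (sprayOf L z₀ u)) =ᶠ[𝓝 v] fun u => C u u := by
    filter_upwards [hHG, hHu, hBC] with u h1 h2 h3
    rw [← h2, h1, sub_apply, h3]; ring
  have d1 := (slam.differentiableAt (by simp)).hasFDerivAt.clm_apply
    (sG.differentiableAt (by simp)).hasFDerivAt
  have d2 := (sC.differentiableAt (by simp)).hasFDerivAt.clm_apply (hasFDerivAt_id v)
  ext w
  have h1 := DFunLike.congr_fun (d1.unique (d2.congr_of_eventuallyEq hphi)) w
  have hsymm : H v w (sprayOf L z₀ v) = H v (sprayOf L z₀ v) w :=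
    (hsz.isSymmSndFDerivAt two_le_infty) _ _
  rw [hHG.self_of_nhds] at hsymm
  have hmix := fderiv_fderiv_mixed_comm hs v w
  -- `h1` is the derivative of `hphi` in the direction `w`. By `hsymm` and `hmix` the terms `B v v
  -- w` cancel and twice `C v w` remains.
  simp at h1
  change lam v (fderiv ℝ (sprayOf L z₀) v w) + H v w (sprayOf L z₀ v) =
    C v w + fderiv ℝ C v w v at h1
  change fderiv ℝ C v w v = B v v w at hmix
  change lam v ((1 / 2 : ℝ) • fderiv ℝ (sprayOf L z₀) v w) = C v w
  rw [map_smul, smul_eq_mul]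
  rw [sub_apply] at hsymm
  linarith

/-- The dual energy is `L` composed with a local inverse of the Legendre map. Extending `L` off the
distribution makes that map one between open sets of `E × E` and `E × E^*`, so the inverse function
theorem applies although the subspaces move with `z`. -/
theorem contDiffAt_dualEnergy [FiniteDimensional ℝ E] {w : E} (hw : P z₀ w = w) (hw0 : w ≠ 0)
    {p : E →L[ℝ] ℝ} (hp : p.comp (P z₀) = fderiv ℝ (L z₀) w) :
    ContDiffAt ℝ ∞ (fun q : E × (E →L[ℝ] ℝ) => dualEnergy (P q.1) (L q.1) q.2) (z₀, p) := by
  have := FiniteDimensional.complete ℝ E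
  have hs := h.smooth w (by rwa [hw])
  set Φ : E × E → E × (E →L[ℝ] ℝ) := fun q => (q.1, fderiv ℝ (L q.1) q.2) with hΦ
  have sΦ2 := contDiffAt_fderiv_right_variable hs
  have sΦ : ContDiffAt ℝ ∞ Φ (z₀, w) := contDiffAt_fst.prodMk sΦ2
  set A := fderiv ℝ (fun q : E × E => fderiv ℝ (L q.1) q.2) (z₀, w) with hA
  have hA' : HasFDerivAt (fun q : E × E => fderiv ℝ (L q.1) q.2) A (z₀, w) :=
    (sΦ2.differentiableAt (by simp)).hasFDerivAt
  have dΦ : HasFDerivAt Φ ((ContinuousLinearMap.fst ℝ E E).prod A) (z₀, w) :=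
    hasFDerivAt_fst.prodMk hA'
  have hAw : ∀ y, A (0, y) = fderiv ℝ (fderiv ℝ (L z₀)) w y := by
    intro y
    have := (hA'.comp w (hasFDerivAt_prodMk_right z₀ w)).fderiv
    change _ = fderiv ℝ ((fun q : E × E => fderiv ℝ (L q.1) q.2) ∘ fun u => (z₀, u)) w y
    rw [this]; simp
  -- The derivative is block triangular, with the identity and the positive definite fibre Hessian
  -- on the diagonal.
  have hinj : Function.Injective
      ((ContinuousLinearMap.fst ℝ E E).prod A : E × E →ₗ[ℝ] E × (E →L[ℝ] ℝ)) := by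
    rw [← LinearMap.ker_eq_bot, LinearMap.ker_eq_bot']
    rintro ⟨x, y⟩ hxy
    have hx : x = 0 := congrArg Prod.fst hxy
    have hy : A (x, y) = 0 := congrArg Prod.snd hxy
    subst hx
    rw [hAw] at hy
    by_contra h0
    have hy0 : y ≠ 0 := by rintro rfl; exact h0 rfl
    have h1 := h.at_base.hess w hw hw0 y hy0
    rw [hy] at h1; simp at h1
  have hdim : Module.finrank ℝ (E × E) = Module.finrank ℝ (E × (E →L[ℝ] ℝ)) := by
    rw [Module.finrank_prod, Module.finrank_prod, finrank_clm_dual]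
  let e : (E × E) ≃L[ℝ] (E × (E →L[ℝ] ℝ)) :=
    (LinearMap.linearEquivOfInjective _ hinj hdim).toContinuousLinearEquiv
  have he : (e : E × E →L[ℝ] E × (E →L[ℝ] ℝ)) = (ContinuousLinearMap.fst ℝ E E).prod A := by
    ext x <;> simp [e]
  have dΦe : HasFDerivAt Φ (e : E × E →L[ℝ] E × (E →L[ℝ] ℝ)) (z₀, w) := by rw [he]; exact dΦ
  set Ψ := sΦ.localInverse dΦe (by simp) with hΨ
  have hΨa : Ψ (Φ (z₀, w)) = (z₀, w) := sΦ.localInverse_apply_image dΦe (by simp)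
  have sΨ : ContDiffAt ℝ ∞ Ψ (Φ (z₀, w)) := sΦ.to_localInverse dΦe (by simp)
  have hright : ∀ᶠ y in 𝓝 (Φ (z₀, w)), Φ (Ψ y) = y :=
    (sΦ.hasStrictFDerivAt' dΦe (by simp)).eventually_right_inverse
  -- The dual energy sees only the restriction of a covector to the range, so the covector is first
  -- cut down to it.
  set R : E × (E →L[ℝ] ℝ) → E × (E →L[ℝ] ℝ) := fun q => (q.1, q.2.comp (P q.1)) with hR
  have sR : ContDiffAt ℝ ∞ R (z₀, p) := by
    refine contDiffAt_fst.prodMk (contDiffAt_snd.clm_comp ?_)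
    exact ContDiffAt.comp (g := P) (z₀, p) h.smooth_proj contDiffAt_fst
  have hRa : R (z₀, p) = Φ (z₀, w) := by simp [hR, hΦ, hp]
  have sΨR : ContDiffAt ℝ ∞ (fun q => Ψ (R q)) (z₀, p) :=
    ContDiffAt.comp (g := Ψ) (z₀, p) (by rw [hRa]; exact sΨ) sR
  have hval : Ψ (R (z₀, p)) = (z₀, w) := by rw [hRa, hΨa]
  have sfin : ContDiffAt ℝ ∞ (fun q => Function.uncurry L (Ψ (R q))) (z₀, p) :=
    ContDiffAt.comp (g := Function.uncurry L) (z₀, p) (by rw [hval]; exact hs) sΨR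
  refine sfin.congr_of_eventuallyEq ?_
  have t1 : Tendsto R (𝓝 (z₀, p)) (𝓝 (Φ (z₀, w))) := by
    rw [← hRa]; exact sR.continuousAt
  have t2 : Tendsto (fun q => Ψ (R q)) (𝓝 (z₀, p)) (𝓝 (z₀, w)) := by
    rw [← hval]; exact sΨR.continuousAt
  have t3 : Tendsto (fun q : E × (E →L[ℝ] ℝ) => q.1) (𝓝 (z₀, p)) (𝓝 z₀) := continuousAt_fst
  filter_upwards [t1.eventually hright, t3.eventually h.fiber,
    t2.eventually (h.eventually_proj_ne_zero (w := w) (by rwa [hw]))] with q h1 h2 h3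
  have hq1 : (Ψ (R q)).1 = q.1 := congrArg Prod.fst h1
  have hq2 : fderiv ℝ (L (Ψ (R q)).1) (Ψ (R q)).2 = q.2.comp (P q.1) := congrArg Prod.snd h1
  rw [hq1] at hq2 h3
  -- The inverse is taken in all of `E`; since its covector kills the kernel of `P q.1`, the
  -- preimage lies in the range.
  have hmem : P q.1 (Ψ (R q)).2 = (Ψ (R q)).2 := by
    apply h2.mem_range_of_fderiv_comp_proj h3
    rw [hq2]; ext y; simp [h2.idem]
  have hne : (Ψ (R q)).2 ≠ 0 := fun h0 => h3 (by rw [h0, map_zero])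
  rw [h2.dualEnergy_of_comp_proj_eq hmem hne hq2.symm]
  change _ = L (Ψ (R q)).1 (Ψ (R q)).2
  rw [hq1]

/-- The Fenchel–Young gap `r ↦ η r - r v + L v` is nonnegative and vanishes at `p`, so its
derivative there is zero. For `v = 0` the point `p` is itself a minimum of η. -/
theorem fderiv_dualEnergy_right [FiniteDimensional ℝ E] {v : E} (hv : P z₀ v = v)
    {p : E →L[ℝ] ℝ} (hp : p.comp (P z₀) = fderiv ℝ (L z₀) v) (q : E →L[ℝ] ℝ) :
    fderiv ℝ (dualEnergy (P z₀) (L z₀)) p q = q v := by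
  rcases eq_or_ne v 0 with rfl | hv0
  · rw [fderiv_zero_of_homogeneous h.at_base.homog] at hp
    have : IsLocalMin (dualEnergy (P z₀) (L z₀)) p := by
      refine Eventually.of_forall fun r => ?_
      rw [dualEnergy_of_comp_proj_eq_zero hp, dualEnergy]
      positivity
    rw [this.fderiv_eq_zero]; simp
  · have hd : DifferentiableAt ℝ (dualEnergy (P z₀) (L z₀)) p := by
      have h1 := h.contDiffAt_dualEnergy hv hv0 hp
      exact (ContDiffAt.comp (g := fun q : E × (E →L[ℝ] ℝ) => dualEnergy (P q.1) (L q.1) q.2)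
        (f := fun r : E →L[ℝ] ℝ => (z₀, r)) p h1 (by fun_prop)).differentiableAt (n := ∞) (by simp)
    have h2 : HasFDerivAt (fun r : E →L[ℝ] ℝ => dualEnergy (P z₀) (L z₀) r - r v + L z₀ v)
        (fderiv ℝ (dualEnergy (P z₀) (L z₀)) p - ContinuousLinearMap.apply ℝ ℝ v) p :=
      (hd.hasFDerivAt.sub (ContinuousLinearMap.apply ℝ ℝ v).hasFDerivAt).add_const _
    have h3 : IsLocalMin (fun r : E →L[ℝ] ℝ => dualEnergy (P z₀) (L z₀) r - r v + L z₀ v) p := by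
      refine Eventually.of_forall fun r => ?_
      have heul := fderiv_apply_self_of_homogeneous h.at_base.homog
        (h.at_base.differentiableAt (w := v) (by rwa [hv]))
      rw [← hp, ContinuousLinearMap.comp_apply, hv] at heul
      have := h.at_base.apply_le_dualEnergy_add r hv
      simp only [h.at_base.dualEnergy_of_comp_proj_eq hv hv0 hp]
      linarith
    have h4 := DFunLike.congr_fun (h3.hasFDerivAt_eq_zero h2) q
    simp at h4
    linarith

/-- The same gap, now as a function of the base point. Since `v` need not stay in the range of `P
z`, the test vector is `P z v`; its motion produces the term with `fderiv ℝ P z₀ y v`. -/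
theorem fderiv_dualEnergy_left [FiniteDimensional ℝ E] {v : E} (hv : P z₀ v = v)
    {p : E →L[ℝ] ℝ} (hp : p.comp (P z₀) = fderiv ℝ (L z₀) v) (y : E) :
    fderiv ℝ (fun z => dualEnergy (P z) (L z) p) z₀ y =
      (p - fderiv ℝ (L z₀) v) (fderiv ℝ P z₀ y v) - fderiv ℝ (fun z => L z v) z₀ y := by
  rcases eq_or_ne v 0 with rfl | hv0
  · rw [fderiv_zero_of_homogeneous h.at_base.homog] at hp
    have h1 : IsLocalMin (fun z => dualEnergy (P z) (L z) p) z₀ := by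
      refine Eventually.of_forall fun r => ?_
      simp only [dualEnergy_of_comp_proj_eq_zero hp]
      rw [dualEnergy]
      positivity
    have h2 : (fun y => L y 0) =ᶠ[𝓝 z₀] fun _ => (0 : ℝ) := h.fiber.mono fun z hz => hz.map_zero
    rw [h1.fderiv_eq_zero, h2.fderiv_eq]; simp
  · have hs := h.smooth v (by rwa [hv])
    have hd : DifferentiableAt ℝ (fun z => dualEnergy (P z) (L z) p) z₀ := by
      have h1 := h.contDiffAt_dualEnergy hv hv0 hp
      exact (ContDiffAt.comp (g := fun q : E × (E →L[ℝ] ℝ) => dualEnergy (P q.1) (L q.1) q.2)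
        (f := fun z : E => (z, p)) z₀ h1 (by fun_prop)).differentiableAt (n := ∞) (by simp)
    have hX : HasFDerivAt (fun z => P z v) ((ContinuousLinearMap.apply ℝ E v).comp (fderiv ℝ P z₀))
        z₀ := by
      have := (h.smooth_proj.differentiableAt (by simp)).hasFDerivAt.clm_apply
        (hasFDerivAt_const v z₀)
      convert! this using 1
      ext; simp
    have hLd : HasFDerivAt (Function.uncurry L) (fderiv ℝ (Function.uncurry L) (z₀, v)) (z₀, P z₀ v) := by
      rw [hv]; exact (hs.differentiableAt (by simp)).hasFDerivAt
    have hLX := hLd.comp z₀ ((hasFDerivAt_id z₀).prodMk hX)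
    have hL1 : ∀ x, fderiv ℝ (Function.uncurry L) (z₀, v) (x, 0) = fderiv ℝ (fun z => L z v) z₀ x := by
      intro x
      rw [hv] at hLd
      have := (hLd.comp z₀ (f := fun y => (y, v)) (hasFDerivAt_prodMk_left z₀ v)).fderiv
      change _ = fderiv ℝ (Function.uncurry L ∘ fun z => (z, v)) z₀ x
      rw [this]; simp
    have hL2 : ∀ x, fderiv ℝ (Function.uncurry L) (z₀, v) (0, x) = fderiv ℝ (L z₀) v x := by
      intro x
      rw [hv] at hLd
      have := (hLd.comp v (hasFDerivAt_prodMk_right z₀ v)).fderiv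
      change _ = fderiv ℝ (Function.uncurry L ∘ fun u => (z₀, u)) v x
      rw [this]; simp
    have h2 := (hd.hasFDerivAt.sub (p.hasFDerivAt.comp z₀ hX)).add hLX
    have h3 : IsLocalMin ((fun z => dualEnergy (P z) (L z) p) - (p ∘ fun z => P z v) +
        Function.uncurry L ∘ fun z => (z, P z v)) z₀ := by
      filter_upwards [h.fiber] with z hz
      have heul := fderiv_apply_self_of_homogeneous h.at_base.homog
        (h.at_base.differentiableAt (w := v) (by rwa [hv]))
      rw [← hp, ContinuousLinearMap.comp_apply, hv] at heul
      have := hz.apply_le_dualEnergy_add p (hz.idem v)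
      simp only [Pi.add_apply, Pi.sub_apply, Function.comp_apply, Function.uncurry_apply_pair,
        h.at_base.dualEnergy_of_comp_proj_eq hv hv0 hp, hv]
      linarith
    have h4 := DFunLike.congr_fun (h3.hasFDerivAt_eq_zero h2) y
    have h5 : fderiv ℝ (Function.uncurry L) (z₀, v) (y, fderiv ℝ P z₀ y v) =
        fderiv ℝ (fun z => L z v) z₀ y + fderiv ℝ (L z₀) v (fderiv ℝ P z₀ y v) := by
      rw [← hL1, ← hL2, ← map_add]; simp
    simp [h5] at h4
    rw [sub_apply]
    linarith

end IsSplitEnergyFamily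

end Family

/-! ### Charts, and smoothness of the orthogonal projection. -/

section Coordinates

variable {E : Type*} [NormedAddCommGroup E] [NormedSpace ℝ E] [FiniteDimensional ℝ E]
  {M : Type*} [TopologicalSpace M] [ChartedSpace E M] [IsManifold 𝓘(ℝ, E) ∞ M] {k : ℕ}
  (S : NonholonomicStructure E M k)
  (g : ContMDiffRiemannianMetric 𝓘(ℝ, E) ∞ E (fun x : M => TangentSpace 𝓘(ℝ, E) x))

theorem frame_coframe {o y : M} (hy : y ∈ (chartAt E o).source) (v : TangentSpace 𝓘(ℝ, E) y) :
    frame o y (coframe o y v) = v :=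
  (trivializationAt E (TangentSpace 𝓘(ℝ, E)) o).symmL_continuousLinearMapAt (R := ℝ) hy v

theorem coframe_frame {o y : M} (hy : y ∈ (chartAt E o).source) (v : E) :
    coframe o y (frame o y v) = v :=
  (trivializationAt E (TangentSpace 𝓘(ℝ, E)) o).continuousLinearMapAt_symmL (R := ℝ) hy v

/-- The tangent space at `o` is modelled by the chart at `o`, whose derivative at `o` is therefore
the identity. -/
theorem coframe_self (o : M) (v : TangentSpace 𝓘(ℝ, E) o) : coframe o o v = v := by
  have h : coframe o o = mfderiv 𝓘(ℝ, E) 𝓘(ℝ, E) (extChartAt 𝓘(ℝ, E) o) o :=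
    TangentBundle.continuousLinearMapAt_trivializationAt (mem_chart_source E o)
  rw [h, mfderiv_extChartAt_self]
  rfl

theorem frame_self (o : M) (v : E) : frame o o v = v := by
  exact (congrArg (frame o o) (coframe_self o v)).symm.trans
    (frame_coframe (mem_chart_source E o) (v : TangentSpace 𝓘(ℝ, E) o))

theorem coframe_eq_snd {o y : M} (hy : y ∈ (chartAt E o).source) (v : TangentSpace 𝓘(ℝ, E) y) :
    coframe o y v = (trivializationAt E (TangentSpace 𝓘(ℝ, E)) o ⟨y, v⟩).2 :=
  (trivializationAt E (TangentSpace 𝓘(ℝ, E)) o).continuousLinearMapAt_apply_of_mem (R := ℝ) hy v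

theorem proj_mem (x : M) (v : TangentSpace 𝓘(ℝ, E) x) : proj S g x v ∈ S.D x :=
  Submodule.projection_apply_mem _ _

theorem proj_of_mem {x : M} {v : TangentSpace 𝓘(ℝ, E) x} (hv : v ∈ S.D x) : proj S g x v = v :=
  Submodule.projection_apply_of_mem_left _ hv

theorem proj_of_mem_perp {x : M} {v : TangentSpace 𝓘(ℝ, E) x} (hv : v ∈ perp S g x) :
    proj S g x v = 0 :=
  Submodule.projection_apply_of_mem_right _ hv

theorem F_zero (x : M) : S.F x 0 = 0 := by
  simpa using S.F_homogeneous x 0 (zero_mem _) 0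

/-- If `F` vanished at `v`, it would vanish on the line of `v`, and its square would have zero
second derivative in the direction `v`. -/
theorem F_pos {x : M} {v : TangentSpace 𝓘(ℝ, E) x} (hv : v ∈ S.D x) (h0 : v ≠ 0) :
    0 < S.F x v := by
  refine lt_of_le_of_ne (S.F_nonneg x v hv) fun h => ?_
  have h1 := S.F_convex x v hv h0 v hv h0
  have h2 : (fun s : ℝ => S.F x (v + s • v) ^ 2) = fun _ => 0 := by
    funext s
    have : v + s • v = (1 + s) • v := by module
    rw [this, S.F_homogeneous x v hv, ← h]; simp
  rw [h2] at h1
  simp at h1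

/-- The projection onto the distribution, in coordinates. -/
def projCoord (o : M) (z : E) : E →L[ℝ] E :=
  coframe o ((extChartAt 𝓘(ℝ, E) o).symm z) ∘L
    proj S g ((extChartAt 𝓘(ℝ, E) o).symm z) ∘L frame o ((extChartAt 𝓘(ℝ, E) o).symm z)

theorem symm_mem_source {o : M} {z : E} (hz : z ∈ (extChartAt 𝓘(ℝ, E) o).target) :
    (extChartAt 𝓘(ℝ, E) o).symm z ∈ (chartAt E o).source := by
  rw [← extChartAt_source 𝓘(ℝ, E)]
  exact (extChartAt 𝓘(ℝ, E) o).map_target hz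

theorem frame_projCoord {o : M} {z : E} (hz : z ∈ (extChartAt 𝓘(ℝ, E) o).target) (w : E) :
    frame o ((extChartAt 𝓘(ℝ, E) o).symm z) (projCoord S g o z w) =
      proj S g _ (frame o ((extChartAt 𝓘(ℝ, E) o).symm z) w) :=
  frame_coframe (symm_mem_source hz) _

theorem projCoord_eq_self_iff {o : M} {z : E} (hz : z ∈ (extChartAt 𝓘(ℝ, E) o).target) (w : E) :
    projCoord S g o z w = w ↔ frame o ((extChartAt 𝓘(ℝ, E) o).symm z) w ∈ S.D _ := by
  constructor
  · intro h
    rw [← h, frame_projCoord S g hz]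
    exact proj_mem S g _ _
  · intro h
    change coframe o _ (proj S g _ (frame o _ w)) = w
    rw [proj_of_mem S g h, coframe_frame (symm_mem_source hz)]

theorem contMDiffAt_extChartAt_symm {o : M} {z : E} (hz : z ∈ (extChartAt 𝓘(ℝ, E) o).target) :
    ContMDiffAt 𝓘(ℝ, E) 𝓘(ℝ, E) ∞ (extChartAt 𝓘(ℝ, E) o).symm z :=
  (contMDiffOn_extChartAt_symm o).contMDiffAt ((isOpen_extChartAt_target o).mem_nhds hz)

theorem contMDiffAt_frame {N : Type*} [NormedAddCommGroup N] [NormedSpace ℝ N] {o : M}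
    {f a : N → E} {x : N} (hf : ContDiffAt ℝ ∞ f x) (ha : ContDiffAt ℝ ∞ a x)
    (hx : f x ∈ (extChartAt 𝓘(ℝ, E) o).target) :
    ContMDiffAt 𝓘(ℝ, N) 𝓘(ℝ, E).tangent ∞
      (fun q => (⟨(extChartAt 𝓘(ℝ, E) o).symm (f q), frame o _ (a q)⟩ : TangentBundle 𝓘(ℝ, E) M))
      x := by
  have hmem : ∀ {y : M} {v}, y ∈ (chartAt E o).source →
      (⟨y, v⟩ : TangentBundle 𝓘(ℝ, E) M) ∈ (trivializationAt E (TangentSpace 𝓘(ℝ, E)) o).source := by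
    intro y v hy
    rw [Trivialization.mem_source]; exact hy
  refine (Trivialization.contMDiffAt_iff (IB := 𝓘(ℝ, E)) (n := ∞) (F := E)
    (e := trivializationAt E (TangentSpace 𝓘(ℝ, E)) o)
    (f := fun q => (⟨(extChartAt 𝓘(ℝ, E) o).symm (f q), frame o _ (a q)⟩ :
      TangentBundle 𝓘(ℝ, E) M)) (hmem (symm_mem_source hx))).2 ⟨(contMDiffAt_extChartAt_symm hx).comp x hf.contMDiffAt, ?_⟩
  refine ha.contMDiffAt.congr_of_eventuallyEq ?_
  filter_upwards [hf.continuousAt ((isOpen_extChartAt_target o).mem_nhds hx)] with q hq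
  rw [← coframe_eq_snd (symm_mem_source hq), coframe_frame (symm_mem_source hq)]

/-- The components of a vector field in the coordinates of the chart at `o`. -/
def fieldCoord (o : M) (X : (y : M) → TangentSpace 𝓘(ℝ, E) y) (z : E) : E :=
  coframe o ((extChartAt 𝓘(ℝ, E) o).symm z) (X ((extChartAt 𝓘(ℝ, E) o).symm z))

theorem contDiffAt_fieldCoord {o : M} {X : (y : M) → TangentSpace 𝓘(ℝ, E) y} {z : E}
    (hz : z ∈ (extChartAt 𝓘(ℝ, E) o).target)
    (hX : SmoothNear X ((extChartAt 𝓘(ℝ, E) o).symm z)) :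
    ContDiffAt ℝ ∞ (fieldCoord o X) z := by
  have h1 := ((trivializationAt E (TangentSpace 𝓘(ℝ, E)) o).contMDiffAt_section_iff
    (IB := 𝓘(ℝ, E)) (n := ∞) (s := X) (symm_mem_source hz)).1 hX.self_of_nhds
  have h2 := (h1.comp z (contMDiffAt_extChartAt_symm hz)).contDiffAt
  refine h2.congr_of_eventuallyEq ?_
  filter_upwards [(isOpen_extChartAt_target o).mem_nhds hz] with q hq
  exact coframe_eq_snd (symm_mem_source hq) _

theorem frame_fieldCoord {o : M} {z : E} (hz : z ∈ (extChartAt 𝓘(ℝ, E) o).target)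
    (X : (y : M) → TangentSpace 𝓘(ℝ, E) y) :
    frame o _ (fieldCoord o X z) = X ((extChartAt 𝓘(ℝ, E) o).symm z) :=
  frame_coframe (symm_mem_source hz) _

theorem contDiffAt_metric {N : Type*} [NormedAddCommGroup N] [NormedSpace ℝ N] {o : M}
    {f a b : N → E} {x : N} (hf : ContDiffAt ℝ ∞ f x) (ha : ContDiffAt ℝ ∞ a x)
    (hb : ContDiffAt ℝ ∞ b x) (hx : f x ∈ (extChartAt 𝓘(ℝ, E) o).target) :
    ContDiffAt ℝ ∞ (fun q => g.inner ((extChartAt 𝓘(ℝ, E) o).symm (f q))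
      (frame o _ (a q)) (frame o _ (b q))) x := by
  have h1 : ContMDiffAt 𝓘(ℝ, N) (𝓘(ℝ, E).prod 𝓘(ℝ, ℝ)) ∞
      (fun q => TotalSpace.mk' ℝ (E := Bundle.Trivial M ℝ) ((extChartAt 𝓘(ℝ, E) o).symm (f q))
        (g.inner ((extChartAt 𝓘(ℝ, E) o).symm (f q)) (frame o _ (a q)) (frame o _ (b q)))) x := by
    apply ContMDiffAt.clm_bundle_apply₂ (F₁ := E) (F₂ := E)
    · exact ContMDiffAt.comp x g.contMDiff.contMDiffAt
        ((contMDiffAt_extChartAt_symm hx).comp x hf.contMDiffAt)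
    · exact contMDiffAt_frame hf ha hx
    · exact contMDiffAt_frame hf hb hx
  simp only [contMDiffAt_totalSpace] at h1
  exact h1.2.contDiffAt

theorem contDiffAt_clm_of_apply {N G : Type*} [NormedAddCommGroup N] [NormedSpace ℝ N]
    [NormedAddCommGroup G] [NormedSpace ℝ G] {f : N → E →L[ℝ] G} {x : N}
    (h : ∀ w, ∀ᶠ y in 𝓝 x, ContDiffAt ℝ ∞ (fun q => f q w) y) : ContDiffAt ℝ ∞ f x := by
  let b := Module.finBasis ℝ E
  have hb : ∀ᶠ y in 𝓝 x, ∀ i, ContDiffAt ℝ ∞ (fun q => f q (b i)) y :=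
    eventually_all.2 fun i => h (b i)
  obtain ⟨U, hU, hUo, hxU⟩ := eventually_nhds_iff.1 hb
  have : ContDiffOn ℝ ∞ f U := by
    rw [contDiffOn_clm_apply]
    intro w y hy
    have hw : (fun q => f q w) = fun q => ∑ i, b.repr w i • f q (b i) := by
      funext q
      conv_lhs => rw [← b.sum_repr w]
      simp only [map_sum, map_smul]
    rw [hw]
    exact (ContDiffAt.sum fun i _ => contDiffAt_const.smul (hU y hy i)).contDiffWithinAt
  exact this.contDiffAt (hUo.mem_nhds hxU)

/-- For a local frame `X i` of the distribution the projection is `T (T' T)⁻¹ T'`, where `T` sends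
coefficients to the combination of the frame and `T'` pairs a vector with the frame; `T' T` is the
Gram matrix. -/
theorem contDiffAt_projCoord {o : M} {z : E} (hz : z ∈ (extChartAt 𝓘(ℝ, E) o).target) :
    ContDiffAt ℝ ∞ (projCoord S g o) z := by
  have := FiniteDimensional.complete ℝ E
  obtain ⟨X, hX, hspan⟩ := S.exists_frame ((extChartAt 𝓘(ℝ, E) o).symm z)
  set ψ := (extChartAt 𝓘(ℝ, E) o).symm with hψ
  have hcont : ContinuousAt ψ z := (contMDiffAt_extChartAt_symm hz).continuousAt
  have htgt : ∀ᶠ y in 𝓝 z, y ∈ (extChartAt 𝓘(ℝ, E) o).target :=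
    (isOpen_extChartAt_target o).mem_nhds hz
  let T : E → (Fin k → ℝ) →L[ℝ] E := fun y =>
    ∑ i, (ContinuousLinearMap.proj (R := ℝ) (φ := fun _ : Fin k => ℝ) i).smulRight (fieldCoord o (X i) y)
  let T' : E → E →L[ℝ] (Fin k → ℝ) := fun y =>
    ContinuousLinearMap.pi fun i => (g.inner (ψ y) (frame o _ (fieldCoord o (X i) y))) ∘L frame o (ψ y)
  have hXs : ∀ i, ContDiffAt ℝ ∞ (fieldCoord o (X i)) z := fun i => contDiffAt_fieldCoord hz (hX i)
  have sT : ContDiffAt ℝ ∞ T z := by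
    refine ContDiffAt.sum fun i _ => ?_
    exact contDiffAt_const.smulRight (hXs i)
  have sT' : ContDiffAt ℝ ∞ T' z := by
    apply contDiffAt_clm_of_apply
    intro w
    have h1 : ∀ i, ∀ᶠ y in 𝓝 z, ContDiffAt ℝ ∞ (fieldCoord o (X i)) y := by
      intro i
      have h2 : ∀ᶠ x in 𝓝 (ψ z), SmoothNear (X i) x := (hX i).eventually_nhds
      filter_upwards [hcont.eventually h2, htgt] with y hy hyt
      exact contDiffAt_fieldCoord hyt hy
    filter_upwards [eventually_all.2 h1, htgt] with y hy hyt
    rw [contDiffAt_pi]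
    intro i
    exact contDiffAt_metric g contDiffAt_id (hy i) contDiffAt_const hyt
  have hTapp : ∀ y a, T y a = ∑ i, a i • fieldCoord o (X i) y := by
    intro y a
    simp [T]
  have hfT : ∀ y ∈ (extChartAt 𝓘(ℝ, E) o).target, ∀ a, frame o (ψ y) (T y a) = ∑ i, a i • X i (ψ y) := by
    intro y hy a
    rw [hTapp, map_sum]
    refine Finset.sum_congr rfl fun i _ => ?_
    rw [map_smul, frame_fieldCoord hy]
  have hT'app : ∀ y ∈ (extChartAt 𝓘(ℝ, E) o).target, ∀ w i, T' y w i = g.inner (ψ y) (X i (ψ y)) (frame o (ψ y) w) := by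
    intro y hy w i
    change g.inner (ψ y) (frame o _ (fieldCoord o (X i) y)) (frame o (ψ y) w) = _
    rw [frame_fieldCoord hy]
  have hTinj : ∀ y ∈ (extChartAt 𝓘(ℝ, E) o).target,
      Submodule.span ℝ (range fun i => X i (ψ y)) = S.D (ψ y) →
      ∀ a, (T' y ∘L T y) a = 0 → a = 0 := by
    intro y hy hsp a ha
    have hli : LinearIndependent ℝ (fun i => X i (ψ y)) := by
      rw [linearIndependent_iff_card_eq_finrank_span, Set.finrank, hsp, S.rank_eq]
      simp
    -- The quadratic form of the Gram matrix at `a` is the squared length of the combination.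
    have h1 : g.inner (ψ y) (∑ i, a i • X i (ψ y)) (∑ i, a i • X i (ψ y)) = 0 := by
      conv_lhs =>
        rw [map_sum]
        simp only [map_smul]
      refine Finset.sum_eq_zero fun i _ => ?_
      have h2 := congrFun ha i
      rw [ContinuousLinearMap.comp_apply, hT'app y hy, hfT y hy] at h2
      rw [g.symm, h2]; simp
    have h3 : ∑ i, a i • X i (ψ y) = 0 := by
      by_contra h0
      exact (g.pos _ _ h0).ne' h1
    exact funext fun i => Fintype.linearIndependent_iff.1 hli a h3 i
  have hGinv : ∀ y ∈ (extChartAt 𝓘(ℝ, E) o).target,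
      Submodule.span ℝ (range fun i => X i (ψ y)) = S.D (ψ y) → (T' y ∘L T y).IsInvertible := by
    intro y hy hsp
    have hinj : Function.Injective ((T' y ∘L T y : (Fin k → ℝ) →L[ℝ] (Fin k → ℝ)) :
        (Fin k → ℝ) →ₗ[ℝ] (Fin k → ℝ)) := by
      rw [← LinearMap.ker_eq_bot, LinearMap.ker_eq_bot']
      exact hTinj y hy hsp
    refine ⟨(LinearEquiv.ofInjectiveEndo _ hinj).toContinuousLinearEquiv, ?_⟩
    ext; simp
  have sPf : ContDiffAt ℝ ∞ (fun y => T y ∘L (T' y ∘L T y).inverse ∘L T' y) z := by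
    obtain ⟨e, he⟩ := hGinv z hz hspan.self_of_nhds
    have h1 : ContDiffAt ℝ ∞ (fun y => (T' y ∘L T y).inverse) z := by
      refine ContDiffAt.comp (g := ContinuousLinearMap.inverse) z ?_ (sT'.clm_comp sT)
      rw [← he]; exact contDiffAt_map_inverse e
    exact sT.clm_comp (h1.clm_comp sT')
  refine sPf.congr_of_eventuallyEq ?_
  filter_upwards [hcont.eventually hspan, htgt] with y hsp hy
  obtain ⟨e, he⟩ := hGinv y hy hsp
  ext w
  set a := (T' y ∘L T y).inverse (T' y w) with ha
  have hGa : T' y (T y a) = T' y w := by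
    change (T' y ∘L T y) a = _
    rw [ha, ← he]; simp
  have hTa : frame o (ψ y) (T y a) ∈ S.D (ψ y) := by
    rw [hfT y hy, ← hsp]
    exact Submodule.sum_mem _ fun i _ => Submodule.smul_mem _ _ (Submodule.subset_span ⟨i, rfl⟩)
  have hperp : frame o (ψ y) (w - T y a) ∈ perp S g (ψ y) := by
    intro v hv
    rw [← hsp] at hv
    induction hv using Submodule.span_induction with
    | mem x hx =>
      obtain ⟨i, rfl⟩ := hx
      change g.inner (ψ y) (X i (ψ y)) _ = 0
      rw [← hT'app y hy, map_sub, hGa, sub_self]; rfl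
    | zero => simp
    | add u v _ _ hu hv => rw [map_add, add_apply, hu, hv, add_zero]
    | smul c u _ hu => rw [map_smul, smul_apply, hu, smul_zero]
  change coframe o (ψ y) (proj S g (ψ y) (frame o (ψ y) w)) = T y a
  have hw : frame o (ψ y) w = frame o (ψ y) (T y a) + frame o (ψ y) (w - T y a) := by
    rw [← map_add]; congr 1; abel
  rw [hw, map_add, proj_of_mem S g hTa, proj_of_mem_perp S g hperp, add_zero,
    coframe_frame (symm_mem_source hy)]

end Coordinates

/-! ### The extended Lagrangian and the sub-Hamiltonian as a dual pair in coordinates. -/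

section Coordinates

variable {E : Type*} [NormedAddCommGroup E] [NormedSpace ℝ E] [FiniteDimensional ℝ E]
  {M : Type*} [TopologicalSpace M] [ChartedSpace E M] [IsManifold 𝓘(ℝ, E) ∞ M] {k : ℕ}
  (S : NonholonomicStructure E M k)
  (g : ContMDiffRiemannianMetric 𝓘(ℝ, E) ∞ E (fun x : M => TangentSpace 𝓘(ℝ, E) x))

theorem frame_ne_zero {o y : M} (hy : y ∈ (chartAt E o).source) {w : E} (hw : w ≠ 0) :
    frame o y w ≠ 0 := by
  intro h
  rw [← coframe_frame hy w, h, map_zero] at hw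
  exact hw rfl

theorem lagrangianCoord_apply {o : M} {z : E} (hz : z ∈ (extChartAt 𝓘(ℝ, E) o).target) (w : E) :
    lagrangianCoord S g o z w = (1 / 2 : ℝ) *
      (S.F ((extChartAt 𝓘(ℝ, E) o).symm z) (frame o _ (projCoord S g o z w)) ^ 2 +
        g.inner ((extChartAt 𝓘(ℝ, E) o).symm z) (frame o _ (w - projCoord S g o z w))
          (frame o _ (w - projCoord S g o z w))) := by
  rw [map_sub, frame_projCoord S g hz]
  rfl

theorem contDiffAt_projCoord_apply {o : M} {z : E} (hz : z ∈ (extChartAt 𝓘(ℝ, E) o).target)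
    (w : E) : ContDiffAt ℝ ∞ (fun q : E × E => projCoord S g o q.1 q.2) (z, w) :=
  (ContDiffAt.comp (g := projCoord S g o) (z, w) (contDiffAt_projCoord S g hz)
    contDiffAt_fst).clm_apply contDiffAt_snd

theorem contDiffAt_F_frame {N : Type*} [NormedAddCommGroup N] [NormedSpace ℝ N] {o : M}
    {f a : N → E} {x : N} (hf : ContDiffAt ℝ ∞ f x) (ha : ContDiffAt ℝ ∞ a x)
    (hx : f x ∈ (extChartAt 𝓘(ℝ, E) o).target) (ha0 : a x ≠ 0)
    (hD : ∀ᶠ q in 𝓝 x, frame o ((extChartAt 𝓘(ℝ, E) o).symm (f q)) (a q) ∈ S.D _) :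
    ContDiffAt ℝ ∞ (fun q => S.F ((extChartAt 𝓘(ℝ, E) o).symm (f q)) (frame o _ (a q))) x := by
  have htgt : ∀ᶠ q in 𝓝 x, f q ∈ (extChartAt 𝓘(ℝ, E) o).target :=
    hf.continuousAt.eventually ((isOpen_extChartAt_target o).mem_nhds hx)
  have hne : ∀ᶠ q in 𝓝 x, a q ≠ 0 := ha.continuousAt.eventually_ne ha0
  obtain ⟨U, hU, hUo, hxU⟩ := eventually_nhds_iff.1 ((hD.and htgt).and hne)
  have hmaps : MapsTo (fun q : N => (⟨(extChartAt 𝓘(ℝ, E) o).symm (f q),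
      frame o _ (a q)⟩ : TangentBundle 𝓘(ℝ, E) M)) U {w | w.2 ∈ S.D w.1 ∧ w.2 ≠ 0} :=
    fun q hq => ⟨(hU q hq).1.1, frame_ne_zero (symm_mem_source (hU q hq).1.2) (hU q hq).2⟩
  have h1 := (contMDiffAt_frame (M := M) hf ha hx).contMDiffWithinAt (s := U)
  have h2 := ContMDiffWithinAt.comp x (S.F_smooth _ (hmaps hxU)) h1 hmaps
  exact (h2.contMDiffAt (hUo.mem_nhds hxU)).contDiffAt

theorem contDiffAt_lagrangianCoord {o : M} {z : E} (hz : z ∈ (extChartAt 𝓘(ℝ, E) o).target)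
    {w : E} (hw : projCoord S g o z w ≠ 0) :
    ContDiffAt ℝ ∞ (Function.uncurry (lagrangianCoord S g o)) (z, w) := by
  have sP := contDiffAt_projCoord_apply S g hz w
  have htgt : ∀ᶠ q : E × E in 𝓝 (z, w), q.1 ∈ (extChartAt 𝓘(ℝ, E) o).target :=
    continuousAt_fst.eventually ((isOpen_extChartAt_target o).mem_nhds hz)
  have h3 : ContDiffAt ℝ ∞ (fun q : E × E => S.F ((extChartAt 𝓘(ℝ, E) o).symm q.1)
      (frame o _ (projCoord S g o q.1 q.2))) (z, w) := by
    refine contDiffAt_F_frame S contDiffAt_fst sP hz hw ?_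
    filter_upwards [htgt] with q hq
    rw [frame_projCoord S g hq]
    exact proj_mem S g _ _
  have h4 := contDiffAt_metric g (N := E × E) (o := o) (f := Prod.fst) (x := (z, w))
    contDiffAt_fst (contDiffAt_snd.sub sP) (contDiffAt_snd.sub sP) hz
  refine ((contDiffAt_const (c := (1 / 2 : ℝ))).mul ((h3.pow 2).add h4)).congr_of_eventuallyEq
    (f₁ := Function.uncurry (lagrangianCoord S g o)) (htgt.mono fun q hq => ?_)
  exact lagrangianCoord_apply S g hq q.2

theorem isSplitEnergy_coord {o : M} {z : E} (hz : z ∈ (extChartAt 𝓘(ℝ, E) o).target) :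
    IsSplitEnergy (projCoord S g o z) (lagrangianCoord S g o z) := by
  set y := (extChartAt 𝓘(ℝ, E) o).symm z with hy
  have hys : y ∈ (chartAt E o).source := symm_mem_source hz
  set P := projCoord S g o z with hP
  set L := lagrangianCoord S g o z with hL
  have hPD : ∀ w, frame o y (P w) ∈ S.D y := by
    intro w
    rw [hP, frame_projCoord S g hz]; exact proj_mem S g _ _
  have hidem : ∀ w, P (P w) = P w := fun w => (projCoord_eq_self_iff S g hz _).2 (hPD w)
  have hLapp : ∀ w, L w = (1 / 2 : ℝ) * (S.F y (frame o y (P w)) ^ 2 +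
      g.inner y (frame o y (w - P w)) (frame o y (w - P w))) := lagrangianCoord_apply S g hz
  have hgnn : ∀ v, 0 ≤ g.inner y v v := by
    intro v
    rcases eq_or_ne v 0 with rfl | h0
    · simp
    · exact (g.pos y v h0).le
  have hhom : ∀ (c : ℝ) w, L (c • w) = c ^ 2 * L w := by
    intro c w
    have h1 : c • w - P (c • w) = c • (w - P w) := by rw [map_smul, smul_sub]
    rw [hLapp, hLapp, h1]
    simp only [map_smul]
    rw [S.F_homogeneous y _ (hPD w), mul_pow, sq_abs]
    simp only [smul_apply, smul_eq_mul]
    ring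
  have hpos : ∀ w, w ≠ 0 → 0 < L w := by
    intro w hw
    rw [hLapp]
    by_cases h0 : P w = 0
    · have h1 := g.pos y _ (frame_ne_zero hys (w := w - P w) (by rwa [h0, sub_zero]))
      positivity
    · have h1 := F_pos S (hPD w) (frame_ne_zero hys h0)
      have := hgnn (frame o y (w - P w))
      positivity
  have hF0 := F_zero S y
  have hsplit : ∀ w, L w = L (P w) + L (w - P w) := by
    intro w
    rw [hLapp, hLapp (P w), hLapp (w - P w)]
    simp only [map_sub, hidem, sub_self, sub_zero, hF0, map_zero]
    ring
  have hsmooth : ∀ w, P w ≠ 0 → ContDiffAt ℝ ∞ L w := fun w hw =>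
    contDiffAt_of_uncurry_left (contDiffAt_lagrangianCoord S g hz hw)
  refine ⟨hidem, hhom, hpos, hsplit, hsmooth, ?_⟩
  intro w hw hw0 x hx
  have hPw : P w ≠ 0 := by rwa [hw]
  -- The orthogonal part of `x` contributes exactly `c * s ^ 2` to `L (w + s • x)`, so the Hessian
  -- of `L` follows from that of `F ^ 2` along `P x` by adding a multiple of `c`.
  set c := L (x - P x) with hc
  have hψ : (fun s : ℝ => S.F y (frame o y w + s • frame o y (P x)) ^ 2) =
      fun s => 2 * L (w + s • x) - 2 * c * s ^ 2 := by
    funext s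
    have h1 : w + s • x - P (w + s • x) = s • (x - P x) := by
      rw [map_add, map_smul, hw]; module
    have h2 : L (w + s • x) = L (P (w + s • x)) + s ^ 2 * c := by
      rw [hsplit, h1, hhom]
    rw [h2, hLapp (P _)]
    simp only [hidem, sub_self, map_zero, map_add, map_smul, hw]
    ring
  have hev : ∀ᶠ s : ℝ in 𝓝 0, P (w + s • x) ≠ 0 := by
    have h1 : ContinuousAt (fun s : ℝ => P (w + s • x)) 0 := by fun_prop
    exact h1.eventually_ne (by simpa using hPw)
  have hd1 : deriv (fun s : ℝ => 2 * L (w + s • x) - 2 * c * s ^ 2) =ᶠ[𝓝 0]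
      fun s => 2 * fderiv ℝ L (w + s • x) x - 2 * c * (2 * s) := by
    filter_upwards [hev] with s hs
    have h1 := hasDerivAt_line (L := L) (w := w) (y := x) (s := s)
      ((hsmooth _ hs).differentiableAt (by simp))
    have h2 := (hasDerivAt_pow 2 s).const_mul (2 * c)
    have h3 := ((h1.const_mul 2).sub h2).deriv
    simpa [Pi.sub_def] using h3
  have hd2 : HasDerivAt (fun s : ℝ => 2 * fderiv ℝ L (w + s • x) x - 2 * c * (2 * s))
      (2 * fderiv ℝ (fderiv ℝ L) w x x - 2 * c * (2 * 1)) 0 := by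
    have hd : DifferentiableAt ℝ (fderiv ℝ L) (w + (0 : ℝ) • x) := by
      rw [zero_smul, add_zero]
      exact ((hsmooth _ hPw).fderiv_right (m := ∞) le_rfl).differentiableAt (by simp)
    have h3 := hd.hasFDerivAt.comp_hasDerivAt (0 : ℝ)
      (((hasDerivAt_id (0 : ℝ)).smul_const x).const_add w)
    have h4 := (h3.clm_apply (hasDerivAt_const (0 : ℝ) x)).const_mul 2
    have h5 := h4.sub (((hasDerivAt_id (0 : ℝ)).const_mul 2).const_mul (2 * c))
    simpa [Pi.sub_def] using h5
  have hit : iteratedDeriv 2 (fun s : ℝ => S.F y (frame o y w + s • frame o y (P x)) ^ 2) 0 =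
      2 * fderiv ℝ (fderiv ℝ L) w x x - 4 * c := by
    rw [hψ, iteratedDeriv_succ, iteratedDeriv_one, hd1.deriv_eq, hd2.deriv]
    ring
  -- Strictness comes from `c` when `x` is orthogonal to the distribution, and from convexity of `F`
  -- otherwise.
  by_cases hPx : P x = 0
  · have h1 : 0 < c := by rw [hc, hPx, sub_zero]; exact hpos x hx
    rw [hPx, map_zero] at hit
    simp only [smul_zero, add_zero] at hit
    rw [iteratedDeriv_const, if_neg (by norm_num)] at hit
    linarith
  · have h1 : 0 ≤ c := by
      rcases eq_or_ne (x - P x) 0 with h0 | h0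
      · rw [hc, h0, hLapp]; simp [hF0]
      · exact (hpos _ h0).le
    have h2 := S.F_convex y _ ((projCoord_eq_self_iff S g hz w).1 hw) (frame_ne_zero hys hw0)
      _ (hPD x) (frame_ne_zero hys hPx)
    change 0 < iteratedDeriv 2 (fun s : ℝ => S.F y (frame o y w + s • frame o y (P x)) ^ 2) 0 at h2
    linarith

theorem isSplitEnergyFamily_coord {o : M} {z : E} (hz : z ∈ (extChartAt 𝓘(ℝ, E) o).target) :
    IsSplitEnergyFamily (projCoord S g o) (lagrangianCoord S g o) z where
  fiber := by
    filter_upwards [(isOpen_extChartAt_target o).mem_nhds hz] with y hy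
    exact isSplitEnergy_coord S g hy
  smooth_proj := contDiffAt_projCoord S g hz
  smooth _ hw := contDiffAt_lagrangianCoord S g hz hw

theorem hamiltonianCoord_eq_dualEnergy {o : M} {z : E}
    (hz : z ∈ (extChartAt 𝓘(ℝ, E) o).target) (p : E →L[ℝ] ℝ) :
    hamiltonianCoord S o z p = dualEnergy (projCoord S g o z) (lagrangianCoord S g o z) p := by
  have hys := symm_mem_source hz
  have hF : ∀ w, projCoord S g o z w = w → (lagrangianCoord S g o z w = 1 / 2 ↔
      S.F ((extChartAt 𝓘(ℝ, E) o).symm z) (frame o _ w) = 1) := by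
    intro w hw
    have h1 := S.F_nonneg _ _ ((projCoord_eq_self_iff S g hz w).1 hw)
    rw [lagrangianCoord_apply S g hz, hw]
    simp only [sub_self, map_zero]
    rw [← pow_eq_one_iff_of_nonneg h1 two_ne_zero]
    constructor <;> intro h <;> linarith
  unfold hamiltonianCoord subHamiltonian dualF dualEnergy
  congr 3
  ext r
  constructor
  · rintro ⟨v, hv, hFv, rfl⟩
    have h1 := frame_coframe hys v
    have h2 : projCoord S g o z (coframe o _ v) = coframe o _ v :=
      (projCoord_eq_self_iff S g hz _).2 (by rwa [h1])
    exact ⟨coframe o _ v, h2, (hF _ h2).2 (by rwa [h1]), rfl⟩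
  · rintro ⟨w, hw, hLw, rfl⟩
    refine ⟨frame o _ w, (projCoord_eq_self_iff S g hz w).1 hw, (hF w hw).1 hLw, ?_⟩
    rw [ContinuousLinearMap.comp_apply, coframe_frame hys]

/-- `legendre` differentiates `L ∘ P`, the spray uses `L` itself; at points of the range the two
derivatives agree. -/
theorem IsSplitEnergy.fderiv_comp_apply_proj {V : Type*} [NormedAddCommGroup V] [NormedSpace ℝ V]
    {P : V →L[ℝ] V} {L : V → ℝ} (h : IsSplitEnergy P L) {w : V} (hw : P w = w) :
    fderiv ℝ (fun u => L (P u)) w = fderiv ℝ L w := by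
  rcases eq_or_ne w 0 with rfl | hw0
  · rw [fderiv_zero_of_homogeneous h.homog]
    exact fderiv_zero_of_homogeneous fun c u => by rw [map_smul, h.homog]
  · have hd : HasFDerivAt L (fderiv ℝ L w) (P w) := by
      rw [hw]; exact (h.differentiableAt (by rwa [hw])).hasFDerivAt
    exact (hd.comp w P.hasFDerivAt).fderiv.trans (h.fderiv_comp_proj hw hw0)

theorem mem_target_self (o : M) : extChartAt 𝓘(ℝ, E) o o ∈ (extChartAt 𝓘(ℝ, E) o).target :=
  mem_extChartAt_target o

theorem projCoord_self (o : M) (w : E) :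
    projCoord S g o (extChartAt 𝓘(ℝ, E) o o) w = proj S g o w := by
  unfold projCoord
  rw [extChartAt_to_inv]
  exact (coframe_self o _).trans (congrArg (proj S g o) (frame_self o w))

theorem legendre_eq_fderiv {o : M} {v : TangentSpace 𝓘(ℝ, E) o} (hv : v ∈ S.D o) :
    legendre S g o v = fderiv ℝ (lagrangianCoord S g o (extChartAt 𝓘(ℝ, E) o o)) v := by
  have h := isSplitEnergy_coord S g (mem_target_self o)
  have hPv : projCoord S g o (extChartAt 𝓘(ℝ, E) o o) v = v :=
    (projCoord_self S g o v).trans (proj_of_mem S g hv)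
  rw [← h.fderiv_comp_apply_proj hPv]
  have hfun : (fun u : E => (1 / 2 : ℝ) * S.F o (proj S g o u) ^ 2) = fun u =>
      lagrangianCoord S g o (extChartAt 𝓘(ℝ, E) o o)
        (projCoord S g o (extChartAt 𝓘(ℝ, E) o o) u) := by
    funext u
    have h1 := lagrangianCoord_apply S g (mem_target_self o)
      (projCoord S g o (extChartAt 𝓘(ℝ, E) o o) u)
    rw [h.idem, sub_self, extChartAt_to_inv] at h1
    have h2 : frame o o (projCoord S g o (extChartAt 𝓘(ℝ, E) o o) u) = proj S g o u :=
      (frame_self o _).trans (projCoord_self S g o u)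
    rw [h2] at h1
    rw [h1]
    simp
  let v' : E := v
  exact congrArg (fun f : E → ℝ => fderiv ℝ f v') hfun

end Coordinates

/-! ### Lie brackets and derivatives along a horizontal curve. -/

section Curves

variable {E : Type*} [NormedAddCommGroup E] [NormedSpace ℝ E] [FiniteDimensional ℝ E]
  {M : Type*} [TopologicalSpace M] [ChartedSpace E M] [IsManifold 𝓘(ℝ, E) ∞ M] {k : ℕ}
  (S : NonholonomicStructure E M k)
  (g : ContMDiffRiemannianMetric 𝓘(ℝ, E) ∞ E (fun x : M => TangentSpace 𝓘(ℝ, E) x))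

theorem fieldCoord_self (o : M) (X : (y : M) → TangentSpace 𝓘(ℝ, E) y) :
    fieldCoord o X (extChartAt 𝓘(ℝ, E) o o) = coframe o o (X o) := by
  unfold fieldCoord
  rw [extChartAt_to_inv]

theorem fieldCoord_eq_mpullbackWithin {o : M} {z : E}
    (hz : z ∈ (extChartAt 𝓘(ℝ, E) o).target) (X : (y : M) → TangentSpace 𝓘(ℝ, E) y) :
    VectorField.mpullbackWithin 𝓘(ℝ, E) 𝓘(ℝ, E) (extChartAt 𝓘(ℝ, E) o).symm X
      (range 𝓘(ℝ, E)) z = fieldCoord o X z := by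
  have hy := symm_mem_source hz
  have h : frame (E := E) o ((extChartAt 𝓘(ℝ, E) o).symm z) =
      mfderivWithin 𝓘(ℝ, E) 𝓘(ℝ, E) (extChartAt 𝓘(ℝ, E) o).symm (range 𝓘(ℝ, E)) z := by
    have h1 := TangentBundle.symmL_trivializationAt (I := 𝓘(ℝ, E)) (𝕜 := ℝ) hy
    rw [(extChartAt 𝓘(ℝ, E) o).right_inv hz] at h1
    exact h1
  have hinv : (mfderivWithin 𝓘(ℝ, E) 𝓘(ℝ, E) (extChartAt 𝓘(ℝ, E) o).symm
      (range 𝓘(ℝ, E)) z).inverse = coframe (E := E) o ((extChartAt 𝓘(ℝ, E) o).symm z) := by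
    rw [← h]
    apply ContinuousLinearMap.inverse_eq
    · ext v; exact frame_coframe hy v
    · ext v; exact coframe_frame hy v
  rw [VectorField.mpullbackWithin_apply, hinv]
  rfl

/-- The manifold bracket is the vector space bracket of the pullbacks by the inverse chart, which
near the base point are the coordinate fields. -/
theorem coframe_mlieBracket (o : M) (X Y : (y : M) → TangentSpace 𝓘(ℝ, E) y) :
    coframe o o (VectorField.mlieBracket 𝓘(ℝ, E) X Y o) =
      fderiv ℝ (fieldCoord o Y) (extChartAt 𝓘(ℝ, E) o o) (coframe o o (X o)) -
        fderiv ℝ (fieldCoord o X) (extChartAt 𝓘(ℝ, E) o o) (coframe o o (Y o)) := by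
  have hev : ∀ X : (y : M) → TangentSpace 𝓘(ℝ, E) y,
      VectorField.mpullbackWithin 𝓘(ℝ, E) 𝓘(ℝ, E) (extChartAt 𝓘(ℝ, E) o).symm X
        (range 𝓘(ℝ, E)) =ᶠ[𝓝 (extChartAt 𝓘(ℝ, E) o o)] fieldCoord o X := by
    intro X
    filter_upwards [(isOpen_extChartAt_target o).mem_nhds (mem_target_self o)] with z hz
    exact fieldCoord_eq_mpullbackWithin hz X
  have h1 : VectorField.lieBracketWithin ℝ
      (VectorField.mpullbackWithin 𝓘(ℝ, E) 𝓘(ℝ, E) (extChartAt 𝓘(ℝ, E) o).symm X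
        (range 𝓘(ℝ, E)))
      (VectorField.mpullbackWithin 𝓘(ℝ, E) 𝓘(ℝ, E) (extChartAt 𝓘(ℝ, E) o).symm Y
        (range 𝓘(ℝ, E)))
      ((extChartAt 𝓘(ℝ, E) o).symm ⁻¹' univ ∩ range 𝓘(ℝ, E)) (extChartAt 𝓘(ℝ, E) o o) =
      fderiv ℝ (fieldCoord o Y) (extChartAt 𝓘(ℝ, E) o o) (coframe o o (X o)) -
        fderiv ℝ (fieldCoord o X) (extChartAt 𝓘(ℝ, E) o o) (coframe o o (Y o)) := by
    rw [(hev X).lieBracketWithin_vectorField_eq_nhds (hev Y), ← fieldCoord_self,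
      ← fieldCoord_self]
    have : ((extChartAt 𝓘(ℝ, E) o).symm ⁻¹' univ ∩ range 𝓘(ℝ, E)) = (univ : Set E) := by simp
    rw [this, VectorField.lieBracketWithin_univ]
    rfl
  rw [← h1, coframe_self, ← VectorField.mlieBracketWithin_univ,
    VectorField.mlieBracketWithin_apply, mfderiv_extChartAt_self]
  exact DFunLike.congr_fun (ContinuousLinearMap.inverse_id (R := ℝ) (M := E)) _

/-- Extend with constant coefficients in a local frame. -/
theorem exists_sectionNear (x : M) {v : TangentSpace 𝓘(ℝ, E) x} (hv : v ∈ S.D x) :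
    ∃ X, SectionNear S.D X x ∧ X x = v := by
  obtain ⟨X, hX, hspan⟩ := S.exists_frame x
  rw [← hspan.self_of_nhds, Submodule.mem_span_range_iff_exists_fun] at hv
  obtain ⟨c, rfl⟩ := hv
  refine ⟨fun y => ∑ i, c i • X i y, ⟨?_, ?_⟩, rfl⟩
  · filter_upwards [eventually_all.2 hX] with y hy
    exact ContMDiffAt.sum_section fun i _ => (hy i).const_smul_section
  · filter_upwards [hspan] with y hy
    rw [← hy]
    exact Submodule.sum_mem _ fun i _ => Submodule.smul_mem _ _ (Submodule.subset_span ⟨i, rfl⟩)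

theorem smoothNear_frame (o : M) (e : E) : SmoothNear (fun y => frame o y e) o := by
  filter_upwards [(chartAt E o).open_source.mem_nhds (mem_chart_source E o)] with y hy
  refine ((trivializationAt E (TangentSpace 𝓘(ℝ, E)) o).contMDiffAt_section_iff
    (IB := 𝓘(ℝ, E)) (n := ∞) (s := fun y => frame o y e) hy).2 ?_
  refine (contMDiffAt_const (c := e)).congr_of_eventuallyEq ?_
  filter_upwards [(chartAt E o).open_source.mem_nhds hy] with q hq
  rw [← coframe_eq_snd hq, coframe_frame hq]

variable {σ : ℝ → M} {t : ℝ}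

theorem hasDerivWithinAt_curve (hσ : MDifferentiableOn 𝓘(ℝ, ℝ) 𝓘(ℝ, E) σ (Icc 0 1))
    (ht : t ∈ Icc (0 : ℝ) 1) :
    HasDerivWithinAt (fun s => extChartAt 𝓘(ℝ, E) (σ t) (σ s))
      (coframe (σ t) (σ t) (velocity σ t)) (Icc 0 1) t := by
  have h1 := ((hσ t ht).hasMFDerivWithinAt).2
  have hset : (extChartAt 𝓘(ℝ, ℝ) t).symm ⁻¹' Icc 0 1 ∩ range 𝓘(ℝ, ℝ) = Icc 0 1 := by
    rw [extChartAt_model_space_eq_id]; simp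
  rw [hset] at h1
  let σ' : ℝ →L[ℝ] E := mfderivWithin 𝓘(ℝ, ℝ) 𝓘(ℝ, E) σ (Icc 0 1) t
  have h2 : HasFDerivWithinAt (fun s => extChartAt 𝓘(ℝ, E) (σ t) (σ s)) σ' (Icc 0 1) t := h1
  rw [coframe_self]
  exact h2.hasDerivWithinAt

theorem eventually_mem_source (hσ : MDifferentiableOn 𝓘(ℝ, ℝ) 𝓘(ℝ, E) σ (Icc 0 1))
    (ht : t ∈ Icc (0 : ℝ) 1) :
    ∀ᶠ s in 𝓝[Icc 0 1] t, σ s ∈ (chartAt E (σ t)).source :=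
  (hσ t ht).continuousWithinAt.eventually
    ((chartAt E (σ t)).open_source.mem_nhds (mem_chart_source E (σ t)))

theorem hasDerivWithinAt_apply_field (hσ : MDifferentiableOn 𝓘(ℝ, ℝ) 𝓘(ℝ, E) σ (Icc 0 1))
    (ht : t ∈ Icc (0 : ℝ) 1) {γ : (t : ℝ) → TangentSpace 𝓘(ℝ, E) (σ t) →L[ℝ] ℝ}
    {γ' : E →L[ℝ] ℝ}
    (hγ : HasDerivWithinAt (fun s => γ s ∘L frame (σ t) (σ s)) γ' (Icc 0 1) t)
    {Y : (y : M) → TangentSpace 𝓘(ℝ, E) y} (hY : SmoothNear Y (σ t)) :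
    HasDerivWithinAt (fun s => γ s (Y (σ s)))
      (γ' (coframe (σ t) (σ t) (Y (σ t))) + (γ t ∘L frame (σ t) (σ t))
        (fderiv ℝ (fieldCoord (σ t) Y) (extChartAt 𝓘(ℝ, E) (σ t) (σ t))
          (coframe (σ t) (σ t) (velocity σ t)))) (Icc 0 1) t := by
  have hYd : HasFDerivAt (fieldCoord (σ t) Y)
      (fderiv ℝ (fieldCoord (σ t) Y) (extChartAt 𝓘(ℝ, E) (σ t) (σ t)))
      (extChartAt 𝓘(ℝ, E) (σ t) (σ t)) := by
    refine DifferentiableAt.hasFDerivAt ?_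
    refine (contDiffAt_fieldCoord (mem_target_self (σ t)) ?_).differentiableAt (by simp)
    rwa [extChartAt_to_inv]
  have h1 := hYd.comp_hasDerivWithinAt t (hasDerivWithinAt_curve hσ ht)
  have h2 := hγ.clm_apply h1
  rw [Function.comp_apply, fieldCoord_self] at h2
  have hval : ∀ s, σ s ∈ (chartAt E (σ t)).source →
      γ s (Y (σ s)) = (γ s ∘L frame (σ t) (σ s))
        ((fieldCoord (σ t) Y ∘ fun s => extChartAt 𝓘(ℝ, E) (σ t) (σ s)) s) := by
    intro s hs
    rw [Function.comp_apply]
    unfold fieldCoord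
    rw [(extChartAt 𝓘(ℝ, E) (σ t)).left_inv (by rwa [extChartAt_source]),
      ContinuousLinearMap.comp_apply, frame_coframe hs]
  refine h2.congr_of_eventuallyEq ?_ (hval t (mem_chart_source E (σ t)))
  filter_upwards [eventually_mem_source hσ ht] with s hs
  exact hval s hs

theorem hasDerivWithinAt_clm_of_apply {G : Type*} [NormedAddCommGroup G] [NormedSpace ℝ G]
    {f : ℝ → E →L[ℝ] G} {f' : E →L[ℝ] G} {s : Set ℝ} {t : ℝ}
    (h : ∀ e, HasDerivWithinAt (fun q => f q e) (f' e) s t) : HasDerivWithinAt f f' s t := by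
  let b := Module.finBasis ℝ E
  have hrep : ∀ φ : E →L[ℝ] G, φ = ∑ i, (LinearMap.toContinuousLinearMap (b.coord i)).smulRight
      (φ (b i)) := by
    intro φ
    ext e
    calc φ e = φ (∑ i, b.repr e i • b i) := by rw [b.sum_repr]
      _ = ∑ i, b.repr e i • φ (b i) := by simp only [map_sum, map_smul]
      _ = _ := by simp [sum_apply]
  have h1 : HasDerivWithinAt (fun q => ∑ i,
      (LinearMap.toContinuousLinearMap (b.coord i)).smulRight (f q (b i)))
      (∑ i, (LinearMap.toContinuousLinearMap (b.coord i)).smulRight (f' (b i))) s t := by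
    refine HasDerivWithinAt.fun_sum fun i _ => ?_
    exact ((ContinuousLinearMap.smulRightL ℝ E G
      (LinearMap.toContinuousLinearMap (b.coord i))).hasFDerivAt.comp_hasDerivWithinAt t (h (b i)))
  rw [← hrep] at h1
  exact h1.congr_of_eventuallyEq (Eventually.of_forall fun q => hrep (f q)) (hrep (f t))

/-- A covector vanishing on the distribution only sees the derivative of the projection in the
derivative of a section of the distribution. -/
theorem apply_fderiv_fieldCoord {o : M} {X : (y : M) → TangentSpace 𝓘(ℝ, E) y}
    (hX : SectionNear S.D X o) {c : E →L[ℝ] ℝ}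
    (hc : ∀ w, c (projCoord S g o (extChartAt 𝓘(ℝ, E) o o) w) = 0) (e : E) :
    c (fderiv ℝ (fieldCoord o X) (extChartAt 𝓘(ℝ, E) o o) e) =
      c (fderiv ℝ (projCoord S g o) (extChartAt 𝓘(ℝ, E) o o) e (coframe o o (X o))) := by
  have hz := mem_target_self (E := E) o
  have hXd : HasFDerivAt (fieldCoord o X) (fderiv ℝ (fieldCoord o X) (extChartAt 𝓘(ℝ, E) o o))
      (extChartAt 𝓘(ℝ, E) o o) := by
    refine DifferentiableAt.hasFDerivAt ?_
    refine (contDiffAt_fieldCoord hz ?_).differentiableAt (by simp)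
    rw [extChartAt_to_inv]; exact hX.1
  have hP : HasFDerivAt (projCoord S g o) (fderiv ℝ (projCoord S g o) (extChartAt 𝓘(ℝ, E) o o))
      (extChartAt 𝓘(ℝ, E) o o) :=
    ((contDiffAt_projCoord S g hz).differentiableAt (by simp)).hasFDerivAt
  -- Differentiate X = P X: the part in which X is differentiated lies in the range of P and is
  -- killed by `c`.
  have hev : fieldCoord o X =ᶠ[𝓝 (extChartAt 𝓘(ℝ, E) o o)]
      fun z => projCoord S g o z (fieldCoord o X z) := by
    have hcont := (contMDiffAt_extChartAt_symm hz).continuousAt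
    rw [ContinuousAt, extChartAt_to_inv] at hcont
    filter_upwards [hcont.eventually hX.2, (isOpen_extChartAt_target o).mem_nhds hz] with z h1 h2
    refine ((projCoord_eq_self_iff S g h2 _).2 ?_).symm
    rwa [frame_fieldCoord h2]
  have h1 := (hP.clm_apply hXd).congr_of_eventuallyEq hev
  have h2 := DFunLike.congr_fun (hXd.unique h1) e
  rw [h2, fieldCoord_self]
  simp only [add_apply, ContinuousLinearMap.comp_apply, ContinuousLinearMap.flip_apply, map_add,
    hc, zero_add]

theorem apply_projCoord_eq_zero {o : M} {c : TangentSpace 𝓘(ℝ, E) o →L[ℝ] ℝ}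
    (hc : ∀ w ∈ S.D o, c w = 0) (w : E) :
    (c ∘L frame o o) (projCoord S g o (extChartAt 𝓘(ℝ, E) o o) w) = 0 := by
  refine hc _ ?_
  have h1 := frame_projCoord S g (mem_target_self o) w
  rw [extChartAt_to_inv] at h1
  change frame o o (projCoord S g o (extChartAt 𝓘(ℝ, E) o o) w) ∈ S.D o
  rw [h1]
  exact proj_mem S g o _

theorem apply_eq_comp_frame {o : M} (c : TangentSpace 𝓘(ℝ, E) o →L[ℝ] ℝ)
    (u : TangentSpace 𝓘(ℝ, E) o) : c u = (c ∘L frame o o) (coframe o o u) := by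
  rw [ContinuousLinearMap.comp_apply, frame_coframe (mem_chart_source E o)]

/-- The bracket enters through ∂Y v - ∂X Y. The first term belongs to the derivative of γ(Y) along
σ, and γ(∂X Y) depends only on `X (σ t)`; thus the choice of extensions is immaterial. -/
theorem hasDelta_iff (hσ : IsHorizontal S σ) (ht : t ∈ Icc (0 : ℝ) 1)
    {γ : (t : ℝ) → TangentSpace 𝓘(ℝ, E) (σ t) →L[ℝ] ℝ} (hγ : ∀ w ∈ S.D (σ t), γ t w = 0)
    (ξ : TangentSpace 𝓘(ℝ, E) (σ t) →L[ℝ] ℝ) :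
    HasDelta S σ γ t ξ ↔ HasDerivWithinAt (fun s => γ s ∘L frame (σ t) (σ s))
      (ξ ∘L frame (σ t) (σ t) - (γ t ∘L frame (σ t) (σ t)) ∘L
        (fderiv ℝ (projCoord S g (σ t)) (extChartAt 𝓘(ℝ, E) (σ t) (σ t))).flip
          (coframe (σ t) (σ t) (velocity σ t))) (Icc 0 1) t := by
  have hc := apply_projCoord_eq_zero S g hγ
  have hz := mem_target_self (E := E) (σ t)
  constructor
  · intro h
    apply hasDerivWithinAt_clm_of_apply
    intro e
    -- Fields Y with constant coordinates suffice to recover the derivative of γ.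
    obtain ⟨X, hX, hXv⟩ := exists_sectionNear S (σ t) (hσ.2 t ht)
    have h1 := h X (fun y => frame (σ t) y e) hX hXv (smoothNear_frame (σ t) e)
    convert! h1 using 1
    have hY : fieldCoord (σ t) (fun y => frame (σ t) y e) =ᶠ[𝓝 (extChartAt 𝓘(ℝ, E) (σ t) (σ t))]
        fun _ => e := by
      filter_upwards [(isOpen_extChartAt_target (σ t)).mem_nhds hz] with z hz'
      exact coframe_frame (symm_mem_source hz') e
    rw [apply_eq_comp_frame (γ t) (VectorField.mlieBracket _ _ _ _), coframe_mlieBracket,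
      hY.fderiv_eq, map_sub, apply_fderiv_fieldCoord S g hX hc, hXv,
      coframe_frame (mem_chart_source E (σ t))]
    simp [sub_eq_add_neg]
  · intro h X Y hX hXv hY
    have h1 := hasDerivWithinAt_apply_field hσ.1 ht h hY
    convert! h1 using 1
    rw [apply_eq_comp_frame (γ t) (VectorField.mlieBracket _ _ _ _), coframe_mlieBracket,
      map_sub, apply_fderiv_fieldCoord S g hX hc, hXv, apply_eq_comp_frame ξ]
    simp only [sub_apply, ContinuousLinearMap.comp_apply, ContinuousLinearMap.flip_apply]
    ring

/-- The restriction of `δ_X γ` to the distribution vanishes if and only if `γ` annihilates the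
brackets with the velocity. -/
theorem HasDelta.comp_proj_eq_zero_iff (hσ : IsHorizontal S σ) (ht : t ∈ Icc (0 : ℝ) 1)
    {γ : (t : ℝ) → TangentSpace 𝓘(ℝ, E) (σ t) →L[ℝ] ℝ} (hγ : IsAnnihilatorSection S σ γ)
    {ξ : TangentSpace 𝓘(ℝ, E) (σ t) →L[ℝ] ℝ} (h : HasDelta S σ γ t ξ) :
    ξ ∘L proj S g (σ t) = 0 ↔ ∀ u ∈ bracketSpan S (σ t) (velocity σ t), γ t u = 0 := by
  have key : ∀ X Y : (y : M) → TangentSpace 𝓘(ℝ, E) y, SectionNear S.D X (σ t) →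
      SectionNear S.D Y (σ t) → X (σ t) = velocity σ t →
      ξ (Y (σ t)) + γ t (VectorField.mlieBracket 𝓘(ℝ, E) X Y (σ t)) = 0 := by
    intro X Y hX hY hXv
    have h1 := h X Y hX hXv hY.1
    -- γ(Y) vanishes along σ, because Y lies in D and γ annihilates D.
    have h2 : HasDerivWithinAt (fun s => γ s (Y (σ s))) 0 (Icc 0 1) t := by
      refine (hasDerivWithinAt_const t (Icc (0 : ℝ) 1) (0 : ℝ)).congr_of_eventuallyEq ?_
        (hγ t ht _ hY.2.self_of_nhds)
      filter_upwards [(hσ.1 t ht).continuousWithinAt.eventually hY.2, self_mem_nhdsWithin]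
        with s hs hs'
      exact hγ s hs' _ hs
    exact ((uniqueDiffOn_Icc one_pos) t ht).eq_deriv _ h1 h2
  constructor
  · intro h0 u hu
    have hle : bracketSpan S (σ t) (velocity σ t) ≤ LinearMap.ker (γ t : _ →ₗ[ℝ] ℝ) := by
      refine sup_le (fun w hw => hγ t ht w hw) (Submodule.span_le.2 ?_)
      rintro u ⟨X, Y, hX, hY, hXv, rfl⟩
      have h1 := key X Y hX hY hXv
      have h2 := DFunLike.congr_fun h0 (Y (σ t))
      rw [ContinuousLinearMap.comp_apply, proj_of_mem S g hY.2.self_of_nhds] at h2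
      have h3 : ξ (Y (σ t)) = 0 := h2
      rw [h3, zero_add] at h1
      exact h1
    exact hle hu
  · intro h0
    ext w
    obtain ⟨X, hX, hXv⟩ := exists_sectionNear S (σ t) (hσ.2 t ht)
    obtain ⟨Y, hY, hYw⟩ := exists_sectionNear S (σ t) (proj_mem S g (σ t) w)
    have h1 := key X Y hX hY hXv
    rw [h0 _ (Submodule.mem_sup_right (Submodule.subset_span ⟨X, Y, hX, hY, hXv, rfl⟩)), hYw,
      add_zero] at h1
    exact h1

end Curves

/-! ### Comparison of the free and the sub-Hamiltonian equations. -/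

section Comparison

variable {E : Type*} [NormedAddCommGroup E] [NormedSpace ℝ E] [FiniteDimensional ℝ E]
  {M : Type*} [TopologicalSpace M] [ChartedSpace E M] [IsManifold 𝓘(ℝ, E) ∞ M] {k : ℕ}
  (S : NonholonomicStructure E M k)
  (g : ContMDiffRiemannianMetric 𝓘(ℝ, E) ∞ E (fun x : M => TangentSpace 𝓘(ℝ, E) x))

theorem legendre_comp_frame {o : M} {v : TangentSpace 𝓘(ℝ, E) o} (hv : v ∈ S.D o) :
    legendre S g o v ∘L frame o o =
      fderiv ℝ (lagrangianCoord S g o (extChartAt 𝓘(ℝ, E) o o)) (coframe o o v) := by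
  rw [legendre_eq_fderiv S g hv, coframe_self]
  ext w
  exact congrArg (fderiv ℝ (lagrangianCoord S g o (extChartAt 𝓘(ℝ, E) o o)) v) (frame_self o w)

theorem projCoord_coframe {o : M} {v : TangentSpace 𝓘(ℝ, E) o} (hv : v ∈ S.D o) :
    projCoord S g o (extChartAt 𝓘(ℝ, E) o o) (coframe o o v) = coframe o o v := by
  rw [projCoord_eq_self_iff S g (mem_target_self o), extChartAt_to_inv,
    frame_coframe (mem_chart_source E o)]
  exact hv

variable {σ : ℝ → M} {t : ℝ}

/-- By λ ∘ N = ∂L/∂x the Barthel derivative of the momentum is the Euler–Lagrange expression of the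
extended Lagrangian. -/
theorem hasBarthelDeriv_momentum_iff (hσ : IsHorizontal S σ) (ht : t ∈ Icc (0 : ℝ) 1)
    (ξ : TangentSpace 𝓘(ℝ, E) (σ t) →L[ℝ] ℝ) :
    HasBarthelDeriv S g σ (momentum S g σ) t ξ ↔
      HasDerivWithinAt (fun s => momentum S g σ s ∘L frame (σ t) (σ s))
        (ξ ∘L frame (σ t) (σ t) + fderiv ℝ (fun z => lagrangianCoord S g (σ t) z
          (coframe (σ t) (σ t) (velocity σ t))) (extChartAt 𝓘(ℝ, E) (σ t) (σ t)))
        (Icc 0 1) t := by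
  have h1 := (isSplitEnergyFamily_coord S g (mem_target_self (E := E) (σ t))).fderiv_comp_fderiv_sprayOf
    (projCoord_coframe S g (hσ.2 t ht))
  rw [← legendre_comp_frame S g (hσ.2 t ht)] at h1
  rw [← h1]
  rfl

theorem fderiv_hamiltonianCoord_right {o : M} (α : TangentSpace 𝓘(ℝ, E) o →L[ℝ] ℝ)
    {v : TangentSpace 𝓘(ℝ, E) o} (hv : v ∈ S.D o)
    (hα : (α ∘L frame o o) ∘L projCoord S g o (extChartAt 𝓘(ℝ, E) o o) =
      legendre S g o v ∘L frame o o) (q : E →L[ℝ] ℝ) :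
    fderiv ℝ (hamiltonianCoord S o (extChartAt 𝓘(ℝ, E) o o)) (α ∘L frame o o) q =
      q (coframe o o v) := by
  rw [legendre_comp_frame S g hv] at hα
  have h1 := (isSplitEnergyFamily_coord S g (mem_target_self o)).fderiv_dualEnergy_right
    (projCoord_coframe S g hv) hα q
  have h2 : hamiltonianCoord S o (extChartAt 𝓘(ℝ, E) o o) = dualEnergy _ _ :=
    funext fun p => hamiltonianCoord_eq_dualEnergy S g (mem_target_self o) p
  rw [h2, h1]

theorem fderiv_hamiltonianCoord_left {o : M} (α : TangentSpace 𝓘(ℝ, E) o →L[ℝ] ℝ)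
    {v : TangentSpace 𝓘(ℝ, E) o} (hv : v ∈ S.D o)
    (hα : (α ∘L frame o o) ∘L projCoord S g o (extChartAt 𝓘(ℝ, E) o o) =
      legendre S g o v ∘L frame o o) :
    fderiv ℝ (fun z => hamiltonianCoord S o z (α ∘L frame o o)) (extChartAt 𝓘(ℝ, E) o o) =
      ((α - legendre S g o v) ∘L frame o o) ∘L
        (fderiv ℝ (projCoord S g o) (extChartAt 𝓘(ℝ, E) o o)).flip (coframe o o v) -
      fderiv ℝ (fun z => lagrangianCoord S g o z (coframe o o v)) (extChartAt 𝓘(ℝ, E) o o) := by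
  have hl := legendre_comp_frame S g hv
  ext y
  have h1 := (isSplitEnergyFamily_coord S g (mem_target_self o)).fderiv_dualEnergy_left
    (projCoord_coframe S g hv) (hα.trans hl) y
  have h2 : (fun z => hamiltonianCoord S o z (α ∘L frame o o)) =ᶠ[𝓝 (extChartAt 𝓘(ℝ, E) o o)]
      fun z => dualEnergy (projCoord S g o z) (lagrangianCoord S g o z) (α ∘L frame o o) := by
    filter_upwards [(isOpen_extChartAt_target o).mem_nhds (mem_target_self o)] with z hz
    exact hamiltonianCoord_eq_dualEnergy S g hz _
  rw [h2.fderiv_eq, h1, ← hl]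
  rfl

/-- The sub-Hamiltonian equations determine the restriction of the momentum to the distribution. -/
theorem comp_projCoord_of_fderiv_hamiltonianCoord {o : M} (α : TangentSpace 𝓘(ℝ, E) o →L[ℝ] ℝ)
    {v : TangentSpace 𝓘(ℝ, E) o}
    (h : ∀ q : E →L[ℝ] ℝ, q (coframe o o v) =
      fderiv ℝ (hamiltonianCoord S o (extChartAt 𝓘(ℝ, E) o o)) (α ∘L frame o o) q) :
    (α ∘L frame o o) ∘L projCoord S g o (extChartAt 𝓘(ℝ, E) o o) =
      legendre S g o v ∘L frame o o := by
  have hE := isSplitEnergy_coord S g (mem_target_self o)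
  -- The restriction of `α` to D is the Legendre transform of some `w` in D, and ∂η/∂p at `α` is
  -- then `w`; hence `w = v`, without assuming `v` in D.
  obtain ⟨w, hw, hpw⟩ : ∃ w, projCoord S g o (extChartAt 𝓘(ℝ, E) o o) w = w ∧
      (α ∘L frame o o) ∘L projCoord S g o (extChartAt 𝓘(ℝ, E) o o) =
        fderiv ℝ (lagrangianCoord S g o (extChartAt 𝓘(ℝ, E) o o)) w := by
    by_cases h0 : (α ∘L frame o o) ∘L projCoord S g o (extChartAt 𝓘(ℝ, E) o o) = 0
    · exact ⟨0, map_zero _, by rw [h0, fderiv_zero_of_homogeneous hE.homog]⟩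
    · obtain ⟨w, hw, -, hpw⟩ := hE.exists_comp_proj_eq_fderiv h0
      exact ⟨w, hw, hpw⟩
  have hwD : frame o o w ∈ S.D o := by
    rw [projCoord_eq_self_iff S g (mem_target_self o), extChartAt_to_inv] at hw
    exact hw
  have hl := legendre_comp_frame S g hwD
  rw [coframe_frame (mem_chart_source E o)] at hl
  have hvw : coframe o o v = w := by
    rw [SeparatingDual.eq_iff_forall_dual_eq (R := ℝ)]
    intro q
    rw [h q, fderiv_hamiltonianCoord_right S g α hwD (hpw.trans hl.symm),
      coframe_frame (mem_chart_source E o)]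
  have hv : v = frame o o w := by rw [← hvw, frame_coframe (mem_chart_source E o)]
  rw [hv, hpw, hl]

theorem legendre_add_comp_projCoord {o : M} {v : TangentSpace 𝓘(ℝ, E) o} (hv : v ∈ S.D o)
    {γ : TangentSpace 𝓘(ℝ, E) o →L[ℝ] ℝ} (hγ : ∀ w ∈ S.D o, γ w = 0) :
    ((legendre S g o v + γ) ∘L frame o o) ∘L projCoord S g o (extChartAt 𝓘(ℝ, E) o o) =
      legendre S g o v ∘L frame o o := by
  have hE := isSplitEnergy_coord S g (mem_target_self o)
  have h1 : (legendre S g o v ∘L frame o o) ∘L projCoord S g o (extChartAt 𝓘(ℝ, E) o o) =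
      legendre S g o v ∘L frame o o := by
    rw [legendre_comp_frame S g hv]
    rcases eq_or_ne (coframe o o v) 0 with h0 | h0
    · rw [h0, fderiv_zero_of_homogeneous hE.homog, ContinuousLinearMap.zero_comp]
    · exact hE.fderiv_comp_proj (projCoord_coframe S g hv) h0
  ext w
  have h2 := DFunLike.congr_fun h1 w
  have h3 := apply_projCoord_eq_zero S g hγ w
  rw [← h2]
  simp only [ContinuousLinearMap.comp_apply, add_apply] at h3 ⊢
  rw [h3, add_zero]

/-- Adding γ does not change the restriction to D, so dx/dt = ∂η/∂p holds automatically and only the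
equation for dp/dt remains. -/
theorem isNormalLift_momentum_add_iff (hσ : IsHorizontal S σ)
    {γ : (t : ℝ) → TangentSpace 𝓘(ℝ, E) (σ t) →L[ℝ] ℝ} (hγ : IsAnnihilatorSection S σ γ) :
    IsNormalLift S σ (fun t => momentum S g σ t + γ t) ↔ ∀ t ∈ Icc (0 : ℝ) 1,
      HasDerivWithinAt (fun s => momentum S g σ s ∘L frame (σ t) (σ s) +
          γ s ∘L frame (σ t) (σ s))
        (fderiv ℝ (fun z => lagrangianCoord S g (σ t) z (coframe (σ t) (σ t) (velocity σ t)))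
            (extChartAt 𝓘(ℝ, E) (σ t) (σ t)) -
          (γ t ∘L frame (σ t) (σ t)) ∘L
            (fderiv ℝ (projCoord S g (σ t)) (extChartAt 𝓘(ℝ, E) (σ t) (σ t))).flip
              (coframe (σ t) (σ t) (velocity σ t))) (Icc 0 1) t := by
  refine forall₂_congr fun t ht => ?_
  have hα := legendre_add_comp_projCoord S g (hσ.2 t ht) (hγ t ht)
  have h1 := fderiv_hamiltonianCoord_left S g _ (hσ.2 t ht) hα
  have h2 := fderiv_hamiltonianCoord_right S g _ (hσ.2 t ht) hα
  rw [add_sub_cancel_left] at h1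
  have h3 : (fun s => (momentum S g σ s + γ s) ∘L frame (σ t) (σ s)) = fun s =>
      momentum S g σ s ∘L frame (σ t) (σ s) + γ s ∘L frame (σ t) (σ s) :=
    funext fun s => ContinuousLinearMap.add_comp _ _ _
  unfold momentum at *
  rw [h1, h3, neg_sub]
  exact ⟨fun h => h.2, fun h => ⟨fun q => (h2 q).symm, h⟩⟩

/-- Subtracting dλ/dt = ξ + ∂L/∂x from the equation for λ + γ cancels ∂L/∂x and leaves the
coordinate form of δγ = -ξ. It also yields differentiability of γ alone. -/
theorem hasDerivWithinAt_momentum_add_iff (hσ : IsHorizontal S σ) (ht : t ∈ Icc (0 : ℝ) 1)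
    {γ : (t : ℝ) → TangentSpace 𝓘(ℝ, E) (σ t) →L[ℝ] ℝ} (hγ : IsAnnihilatorSection S σ γ)
    {ξ : TangentSpace 𝓘(ℝ, E) (σ t) →L[ℝ] ℝ}
    (hξ : HasBarthelDeriv S g σ (momentum S g σ) t ξ) :
    HasDerivWithinAt (fun s => momentum S g σ s ∘L frame (σ t) (σ s) +
          γ s ∘L frame (σ t) (σ s))
        (fderiv ℝ (fun z => lagrangianCoord S g (σ t) z (coframe (σ t) (σ t) (velocity σ t)))
            (extChartAt 𝓘(ℝ, E) (σ t) (σ t)) -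
          (γ t ∘L frame (σ t) (σ t)) ∘L
            (fderiv ℝ (projCoord S g (σ t)) (extChartAt 𝓘(ℝ, E) (σ t) (σ t))).flip
              (coframe (σ t) (σ t) (velocity σ t))) (Icc 0 1) t ↔ HasDelta S σ γ t (-ξ) := by
  rw [hasBarthelDeriv_momentum_iff S g hσ ht] at hξ
  rw [hasDelta_iff S g hσ ht (hγ t ht), ContinuousLinearMap.neg_comp]
  constructor
  · intro h
    convert! h.sub hξ using 1
    · funext s; simp
    · abel
  · intro h
    convert! hξ.add h using 1
    abel

theorem HasDelta.unique (hσ : IsHorizontal S σ) (ht : t ∈ Icc (0 : ℝ) 1)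
    {γ : (t : ℝ) → TangentSpace 𝓘(ℝ, E) (σ t) →L[ℝ] ℝ}
    {ξ ξ' : TangentSpace 𝓘(ℝ, E) (σ t) →L[ℝ] ℝ} (h : HasDelta S σ γ t ξ)
    (h' : HasDelta S σ γ t ξ') : ξ = ξ' := by
  obtain ⟨X, hX, hXv⟩ := exists_sectionNear S (σ t) (hσ.2 t ht)
  ext u
  have h1 := ((uniqueDiffOn_Icc (one_pos : (0 : ℝ) < 1)) t ht).eq_deriv _
    (h X _ hX hXv (smoothNear_frame (σ t) (coframe (σ t) (σ t) u)))
    (h' X _ hX hXv (smoothNear_frame (σ t) (coframe (σ t) (σ t) u)))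
  rw [frame_coframe (mem_chart_source E (σ t))] at h1
  exact add_right_cancel h1

theorem HasBarthelDeriv.unique (ht : t ∈ Icc (0 : ℝ) 1)
    {α : (t : ℝ) → TangentSpace 𝓘(ℝ, E) (σ t) →L[ℝ] ℝ}
    {ξ ξ' : TangentSpace 𝓘(ℝ, E) (σ t) →L[ℝ] ℝ} (h : HasBarthelDeriv S g σ α t ξ)
    (h' : HasBarthelDeriv S g σ α t ξ') : ξ = ξ' := by
  have h1 := add_right_cancel (((uniqueDiffOn_Icc (one_pos : (0 : ℝ) < 1)) t ht).eq_deriv _ h h')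
  ext u
  rw [apply_eq_comp_frame ξ, h1, ← apply_eq_comp_frame ξ']

theorem coProj_add_coProjCompl (x : M) (ξ : TangentSpace 𝓘(ℝ, E) x →L[ℝ] ℝ) :
    coProj S g x ξ + coProjCompl S g x ξ = ξ := by
  ext u
  simp [coProj, coProjCompl]

theorem coProj_neg (x : M) (ξ : TangentSpace 𝓘(ℝ, E) x →L[ℝ] ℝ) :
    coProj S g x (-ξ) = -coProj S g x ξ :=
  ContinuousLinearMap.neg_comp _ _

theorem coProjCompl_neg (x : M) (ξ : TangentSpace 𝓘(ℝ, E) x →L[ℝ] ℝ) :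
    coProjCompl S g x (-ξ) = -coProjCompl S g x ξ :=
  ContinuousLinearMap.neg_comp _ _

variable {S g} in
-- From δγ = -∇^B λ: the D^0 part is the transport equation, and ∇^H λ = 0 makes δγ vanish on D.
theorem IsVakonomicMultiplier.isComparisonSection (hσ : IsHorizontal S σ)
    {γ : (t : ℝ) → TangentSpace 𝓘(ℝ, E) (σ t) →L[ℝ] ℝ} (h : IsVakonomicMultiplier S g σ γ)
    (hN : SolvesNonholonomic S g σ) : IsComparisonSection S g σ γ := by
  obtain ⟨hγ, hL⟩ := h
  rw [isNormalLift_momentum_add_iff S g hσ hγ] at hL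
  have key : ∀ t ∈ Icc (0 : ℝ) 1, ∃ ξ, HasBarthelDeriv S g σ (momentum S g σ) t ξ ∧
      coProjCompl S g (σ t) ξ = 0 ∧ HasDelta S σ γ t (-ξ) := by
    intro t ht
    obtain ⟨ξ, hξ, h0⟩ := hN t ht
    exact ⟨ξ, hξ, h0.symm, (hasDerivWithinAt_momentum_add_iff S g hσ ht hγ hξ).1 (hL t ht)⟩
  refine ⟨hγ, fun t ht => ?_, fun t ht => ?_⟩ <;> obtain ⟨ξ, hξ, h0, hδ⟩ := key t ht
  · exact ⟨_, ⟨ξ, hξ, rfl⟩, -ξ, hδ, (coProj_neg S g _ ξ).symm⟩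
  · refine (hδ.comp_proj_eq_zero_iff S g hσ ht hγ).1 ?_
    change coProjCompl S g (σ t) (-ξ) = 0
    rw [coProjCompl_neg, h0, neg_zero]

variable {S g} in
-- The bracket condition removes the D^* part of δγ, so (∗) prescribes all of δγ and not only its
-- projection.
theorem IsComparisonSection.exists_hasBarthelDeriv (hσ : IsHorizontal S σ)
    {γ : (t : ℝ) → TangentSpace 𝓘(ℝ, E) (σ t) →L[ℝ] ℝ} (h : IsComparisonSection S g σ γ)
    (ht : t ∈ Icc (0 : ℝ) 1) : ∃ ξ δ, HasBarthelDeriv S g σ (momentum S g σ) t ξ ∧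
      HasDelta S σ γ t δ ∧ δ = -coProj S g (σ t) ξ := by
  obtain ⟨β, ⟨ξ, hξ, rfl⟩, δ, hδ, hβ⟩ := h.2.1 t ht
  refine ⟨ξ, δ, hξ, hδ, ?_⟩
  have h1 : coProjCompl S g (σ t) δ = 0 :=
    (hδ.comp_proj_eq_zero_iff S g hσ ht h.1).2 (h.2.2 t ht)
  rw [← coProj_add_coProjCompl S g (σ t) δ, h1, add_zero, ← hβ]

variable {S g} in
theorem IsComparisonSection.isVakonomicMultiplier (hσ : IsHorizontal S σ)
    {γ : (t : ℝ) → TangentSpace 𝓘(ℝ, E) (σ t) →L[ℝ] ℝ} (h : IsComparisonSection S g σ γ)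
    (hN : SolvesNonholonomic S g σ) : IsVakonomicMultiplier S g σ γ := by
  refine ⟨h.1, ?_⟩
  rw [isNormalLift_momentum_add_iff S g hσ h.1]
  intro t ht
  obtain ⟨ξ, δ, hξ, hδ, hδξ⟩ := h.exists_hasBarthelDeriv hσ ht
  obtain ⟨ξ', hξ', h0⟩ := hN t ht
  obtain rfl := hξ.unique S g ht hξ'
  refine (hasDerivWithinAt_momentum_add_iff S g hσ ht h.1 hξ).2 ?_
  have h1 := coProj_add_coProjCompl S g (σ t) ξ
  rw [← h0, add_zero] at h1
  rwa [hδξ, h1] at hδ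

variable {S g} in
-- The multiplier property gives δγ = -∇^B λ, while (∗) gives δγ = -P^*(∇^B λ); by uniqueness of δγ
-- the D^* part of ∇^B λ is zero.
theorem IsComparisonSection.solvesNonholonomic (hσ : IsHorizontal S σ)
    {γ : (t : ℝ) → TangentSpace 𝓘(ℝ, E) (σ t) →L[ℝ] ℝ} (h : IsComparisonSection S g σ γ)
    (hV : IsVakonomicMultiplier S g σ γ) : SolvesNonholonomic S g σ := by
  intro t ht
  obtain ⟨ξ, δ, hξ, hδ, hδξ⟩ := h.exists_hasBarthelDeriv hσ ht
  have hL := (isNormalLift_momentum_add_iff S g hσ h.1).1 hV.2 t ht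
  have h1 := hδ.unique S hσ ht
    ((hasDerivWithinAt_momentum_add_iff S g hσ ht h.1 hξ).1 hL)
  refine ⟨ξ, hξ, ?_⟩
  have h2 := coProj_add_coProjCompl S g (σ t) ξ
  rw [hδξ, neg_inj] at h1
  rw [h1] at h2
  exact (left_eq_add.1 h2.symm).symm

variable {S} in
-- The difference of the lift and the momentum annihilates D, because the first Hamilton equation
-- fixes the lift on D.
theorem IsNormalLift.exists_isVakonomicMultiplier
    {α : (t : ℝ) → TangentSpace 𝓘(ℝ, E) (σ t) →L[ℝ] ℝ} (h : IsNormalLift S σ α) :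
    ∃ γ, IsVakonomicMultiplier S g σ γ := by
  refine ⟨fun t => α t - momentum S g σ t, fun t ht w hw => ?_, ?_⟩
  · have h1 := comp_projCoord_of_fderiv_hamiltonianCoord S g (α t) (h t ht).1
    have h2 := DFunLike.congr_fun h1 (coframe (σ t) (σ t) w)
    rw [ContinuousLinearMap.comp_apply, projCoord_coframe S g hw, ← apply_eq_comp_frame,
      ← apply_eq_comp_frame] at h2
    rw [sub_apply, h2]
    exact sub_self _
  · simpa using h

end Comparison

end SubFinsler

end

theorem mainTheorem1 {E : Type*} [NormedAddCommGroup E] [NormedSpace ℝ E] [FiniteDimensional ℝ E]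
    {M : Type*} [TopologicalSpace M] [T2Space M] [SecondCountableTopology M]
    [ChartedSpace E M] [IsManifold 𝓘(ℝ, E) ∞ M] {k : ℕ}
    (S : SubFinsler.NonholonomicStructure E M k)
    (g : ContMDiffRiemannianMetric 𝓘(ℝ, E) ∞ E (fun x : M => TangentSpace 𝓘(ℝ, E) x))
    (σ : ℝ → M) (hσ : SubFinsler.IsHorizontal S σ) :
    (SubFinsler.SolvesNonholonomic S g σ →
      (SubFinsler.SolvesVakonomic S σ ↔ ∃ γ, SubFinsler.IsComparisonSection S g σ γ)) ∧
    (SubFinsler.SolvesVakonomic S σ →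
      (SubFinsler.SolvesNonholonomic S g σ ↔
        ∃ γ, SubFinsler.IsVakonomicMultiplier S g σ γ ∧
          SubFinsler.IsComparisonSection S g σ γ)) ∧
    (∀ γ : (t : ℝ) → TangentSpace 𝓘(ℝ, E) (σ t) →L[ℝ] ℝ,
      (SubFinsler.SolvesNonholonomic S g σ →
        (SubFinsler.IsVakonomicMultiplier S g σ γ ↔ SubFinsler.IsComparisonSection S g σ γ)) ∧
      (SubFinsler.IsVakonomicMultiplier S g σ γ →
        (SubFinsler.SolvesNonholonomic S g σ ↔ SubFinsler.IsComparisonSection S g σ γ))) := by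
  -- The third assertion is the two-out-of-three principle for a fixed γ; the first two follow from
  -- it once a normal lift is known to supply a multiplier.
  refine ⟨fun hN => ⟨?_, ?_⟩, fun hV => ⟨fun hN => ?_, ?_⟩, fun γ =>
    ⟨fun hN => ⟨fun h => h.isComparisonSection hσ hN, fun h => h.isVakonomicMultiplier hσ hN⟩,
      fun hV => ⟨fun hN => hV.isComparisonSection hσ hN, fun h => h.solvesNonholonomic hσ hV⟩⟩⟩
  · rintro ⟨α, hα⟩
    obtain ⟨γ, hγ⟩ := hα.exists_isVakonomicMultiplier g
    exact ⟨γ, hγ.isComparisonSection hσ hN⟩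
  · rintro ⟨γ, hγ⟩
    exact ⟨_, (hγ.isVakonomicMultiplier hσ hN).2⟩
  · obtain ⟨α, hα⟩ := hV
    obtain ⟨γ, hγ⟩ := hα.exists_isVakonomicMultiplier g
    exact ⟨γ, hγ, hγ.isComparisonSection hσ hN⟩
  · rintro ⟨γ, hγ, hc⟩
    exact hc.solvesNonholonomic hσ hγ
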